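/- Let $p_0\le M$ be fixed nonnegative integers and let $\tau>0$ be a constant. For each $n$ let $p=p_n>p_0$, and let $f_n\in C[0,1]^p$. Put $Z_p=\{1,\dots,p\}$, $\mathcal A_0=\{1,\dots,p_0\}$, $\mathcal U_0=\{\mathcal A\subset Z_p:|\mathcal A|=M,\ \mathcal A_0\subset\mathcal A\}$ and $\mathcal U_1=\{\mathcal A\subset Z_p:|\mathcal A|=M,\ \mathcal A_0\setminus\mathcal A\ne\emptyset\}$. Definitions. For $\mathcal A\subset Z_p$ let $\beta_0(\mathcal A)\in\mathbb R$ and $\beta(\mathcal A)\in\mathbb R^p$, with $\beta(\mathcal A)_j=0$ for $j\notin\mathcal A$, be the minimizer of $\int_{[0,1]^p}\big(f_n(x)-\phi_0-\phi'x\big)^2dx$ over all $\phi_0\in\mathbb R$ and all $\phi\in\mathbb R^p$ that vanish outside $\mathcal A$. For an $n\times p$ matrix $X$ with rows $x_1',\dots,x_n'$ in $[0,1)^p$ and for $y=(f_n(x_1),\dots,f_n(x_n))'$, let $X_{\mathcal A}$ consist of the columns of $X$ with index in $\mathcal A$, let $$\begin{pmatrix}\widehat\beta_0(\mathcal A)\\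 \widehat\beta_{\mathcal A}\end{pmatrix}=\begin{pmatrix}n&1_n'X_{\mathcal A}\\ X_{\mathcal A}'1_n&X_{\mathcal A}'X_{\mathcal A}\end{pmatrix}^{-1}\begin{pmatrix}1_n'y\\ X_{\mathcal A}'y\end{pmatrix},$$ and let $\widehat\beta(\mathcal A)\in\mathbb R^p$ be $\widehat\beta_{\mathcal A}$ expanded by zeros outside $\mathcal A$. The Hardy–Krause variation of $g:[0,1]^p\to\mathbb R$ is $V_{HK}(g)=\sum_{\emptyset\ne u\subset Z_p}V^{Vit}(g_u)$, where $g_u:[0,1]^u\to\mathbb R$ is the restriction of $g$ to the face on which $x_j=1$ for all $j\notin u$. Here the Vitali variation $V^{Vit}(h)$ is the supremum, over all partitions $\Pi$ of the cube into finitely many non-overlapping boxes, of $\sum_{J\in\Pi}|\Delta_J(h)|$, with $\Delta_J(h)$ the sum of the values of $h$ at the vertices of $J$ with alternating signs at neighbouring vertices. Assumptions. For each $n$ there are $\widetilde f_n\in C[0,1]^{p_0}$ with $V_{HK}(\widetilde f_n)<\infty$ and $\eta_n>0$ such that $$\sup_{x\in[0,1]^p}\big|f_n(x)-\widetilde f_n(x_1,\dots,x_{p_0})\big|<\eta_n,\qquad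 \Big|\int_{[0,1]^p}x_jf_n(x)\,dx-\frac12\int_{[0,1]^p}f_n(x)\,dx\Big|>\tau\quad(j=1,\dots,p_0).$$ Write $R_{\mathcal A}(x)=\widetilde f_n(x_1,\dots,x_{p_0})-\beta_0(\mathcal A)-x'\beta(\mathcal A)$ and $$C_{1n}=\max_{j=1,\dots,p}\max\big(V_{HK}(\widetilde f_n),V_{HK}(x_j\widetilde f_n)\big),\quad C_{2n}=\max_{[0,1]^p}|f_n|,\quad C_{3n}=\max_{[0,1]^p}|R_{\mathcal A_0}|,$$ $$C_{4n}=\max_{\mathcal A\in\mathcal U_1}\max_{[0,1]^p}|R_{\mathcal A}|,\quad V_{1n}=V_{HK}(R_{\mathcal A_0}),\quad V_{2n}=\max_{\mathcal A\in\mathcal U_1}V_{HK}(R_{\mathcal A}).$$ As $n\to\infty$, $\eta_n=O(n^{-\gamma_1})$, $V_{1n}=O(n^{\gamma_2})$, $V_{2n}=O(n^{\gamma_3})$, $C_{1n}=O(n^{\gamma_4})$, $C_{2n}=O(n^{\gamma_5})$, $C_{3n}=O(n^{\gamma_6})$, $C_{4n}=O(n^{\gamma_7})$ and $\log p=O(n^{\gamma_{10}})$,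 where, with $\tilde\gamma_0=(1-\gamma_{10})/2$, $$\gamma_1>0,\quad 0<\gamma_{10}<1,\quad \gamma_2,\gamma_3,\gamma_4,\gamma_5<\tilde\gamma_0,\quad \gamma_6,\gamma_7<\gamma_1,$$ $$\gamma_4+\gamma_6<\tilde\gamma_0,\quad \gamma_5+\gamma_6<\tilde\gamma_0,\quad \gamma_4+\gamma_7<\tilde\gamma_0,\quad \gamma_5+\gamma_7<\tilde\gamma_0.$$ For each $n$ the entries $x_{ij}$ ($1\le i\le n$, $1\le j\le p$) of the design matrix $X$ are independent and uniformly distributed on $[0,1)$, and $y_i=f_n(x_i)$. Conclusion. As $n\to\infty$, $$P\Big(\max_{\mathcal A\in\mathcal U_0}\big\|y-1_n\widehat\beta_0(\mathcal A)-X\widehat\beta(\mathcal A)\big\|^2<\min_{\mathcal A_1\in\mathcal U_1}\big\|y-1_n\widehat\beta_0(\mathcal A_1)-X\widehat\beta(\mathcal A_1)\big\|^2\Big)\to1,$$ where a minimum over the empty set is $+\infty$. -/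

import Mathlib

open Filter Topology MeasureTheory ProbabilityTheory Asymptotics
open scoped ENNReal

namespace LinearScreening

/-- The closed unit cube `[0,1]^ι`. -/
def cube (ι : Type*) : Set (ι → ℝ) := Set.Icc 0 1

/-- `sup_{x ∈ [0,1]^ι} |g x|`, as an extended nonnegative number. -/
noncomputable def cubeSup {ι : Type*} (g : (ι → ℝ) → ℝ) : ℝ≥0∞ :=
  ⨆ x ∈ cube ι, ENNReal.ofReal |g x|

/-- The sequence `a` of extended nonnegative numbers is `O(n^γ)`. In particular it is finite for
all large `n`. -/
def IsBigOPow (a : ℕ → ℝ≥0∞) (γ : ℝ) : Prop :=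
  ∃ C : ℝ, ∀ᶠ n : ℕ in atTop, a n ≤ ENNReal.ofReal (C * (n : ℝ) ^ γ)

section Variation

variable {ι : Type*} [Fintype ι] [DecidableEq ι]

/-- The sum of the values of `g` at the vertices of the box `[a, b]`, with alternating signs at
neighbouring vertices. -/
noncomputable def boxDiff (g : (ι → ℝ) → ℝ) (a b : ι → ℝ) : ℝ :=
  ∑ s : Finset ι, (-1) ^ s.card * g (fun i => if i ∈ s then a i else b i)

/-- `Q` (a finite set of pairs `(a, b)`, each standing for the box `[a, b]`) is a partition of the
unit cube into finitely many non-overlapping nondegenerate boxes. -/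
def IsBoxPartition (Q : Finset ((ι → ℝ) × (ι → ℝ))) : Prop :=
  (∀ J ∈ Q, ∀ i, J.1 i < J.2 i) ∧
  (⋃ J ∈ Q, Set.Icc J.1 J.2) = cube ι ∧
  ∀ J ∈ Q, ∀ K ∈ Q, J ≠ K →
    Disjoint (Set.univ.pi fun i => Set.Ioo (J.1 i) (J.2 i))
      (Set.univ.pi fun i => Set.Ioo (K.1 i) (K.2 i))

/-- The Vitali variation of `g` on the unit cube. -/
noncomputable def vitaliVariation (g : (ι → ℝ) → ℝ) : ℝ≥0∞ :=
  ⨆ (Q : Finset ((ι → ℝ) × (ι → ℝ))) (_ : IsBoxPartition Q),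
    ∑ J ∈ Q, ENNReal.ofReal |boxDiff g J.1 J.2|

/-- The point `z_u : 1`, which agrees with `z` on the coordinates in `u` and is `1` elsewhere. -/
noncomputable def glueOne (u : Finset ι) (z : u → ℝ) : ι → ℝ :=
  fun i => if h : i ∈ u then z ⟨i, h⟩ else 1

/-- The Hardy-Krause variation of `g` (anchored at `(1, …, 1)`): the sum, over all nonempty sets `u`
of coordinates, of the Vitali variation of `g` restricted to the face `x_j = 1` (`j ∉ u`). A
coordinate on which `g` does not depend contributes nothing, so the value does not change when a
function of some of the coordinates is regarded as a function of all of them. -/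
noncomputable def hkVariation (g : (ι → ℝ) → ℝ) : ℝ≥0∞ :=
  ∑ u : Finset ι with u.Nonempty, vitaliVariation fun z : u → ℝ => g (glueOne u z)

end Variation

section Submodels

/-- The true submodel `{1, …, p₀}` among `p` variables. -/
def trueModel (p₀ p : ℕ) : Finset (Fin p) := {j | (j : ℕ) < p₀}

/-- The sets of `M` variables that contain the true submodel. -/
def goodModels (p₀ M p : ℕ) : Finset (Finset (Fin p)) :=
  {A | A.card = M ∧ trueModel p₀ p ⊆ A}

/-- The sets of `M` variables that miss part of the true submodel. -/
def badModels (p₀ M p : ℕ) : Finset (Finset (Fin p)) :=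
  {A | A.card = M ∧ (trueModel p₀ p \ A).Nonempty}

/-- A function of the first `p₀` variables, regarded as a function of all `p` variables. -/
def liftFun {p₀ p : ℕ} (h : p₀ ≤ p) (g : (Fin p₀ → ℝ) → ℝ) : (Fin p → ℝ) → ℝ :=
  fun x => g fun i => x (Fin.castLE h i)

end Submodels

section Population

variable {p : ℕ}

/-- The affine function `c.1 + ∑ j, c.2 j * x j`. -/
noncomputable def affineFun (c : ℝ × (Fin p → ℝ)) (x : Fin p → ℝ) : ℝ :=
  c.1 + ∑ j, c.2 j * x j

/-- The mean squared error of the affine approximation `c` of `f` on the unit cube. -/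
noncomputable def meanSqError (f : (Fin p → ℝ) → ℝ) (c : ℝ × (Fin p → ℝ)) : ℝ :=
  ∫ x in cube (Fin p), (f x - affineFun c x) ^ 2

/-- `c` minimizes the mean squared error among the affine functions of the variables in `A`
(whose slopes, as vectors of length `p`, vanish outside `A`). -/
def IsBestLinear (f : (Fin p → ℝ) → ℝ) (A : Finset (Fin p)) (c : ℝ × (Fin p → ℝ)) : Prop :=
  (∀ j ∉ A, c.2 j = 0) ∧
  ∀ c' : ℝ × (Fin p → ℝ), (∀ j ∉ A, c'.2 j = 0) → meanSqError f c ≤ meanSqError f c'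

/-- The best linear approximation of `f` based on the variables in `A`: the pair of the intercept
`β₀(A)` and the slope vector `β(A)`, expanded by zeros to length `p`. For `f` continuous on the
cube the minimizer exists and is unique. -/
noncomputable def bestLinear (f : (Fin p → ℝ) → ℝ) (A : Finset (Fin p)) : ℝ × (Fin p → ℝ) :=
  Classical.epsilon (IsBestLinear f A)

end Population

section Growth

variable {p₀ p : ℕ}

/-- `x ↦ g(x₁, …, x_{p₀}) - β₀(A) - x'β(A)`, where the coefficients are those of `f`. -/
noncomputable def residual (h : p₀ ≤ p) (f : (Fin p → ℝ) → ℝ) (g : (Fin p₀ → ℝ) → ℝ)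
    (A : Finset (Fin p)) : (Fin p → ℝ) → ℝ :=
  fun x => liftFun h g x - affineFun (bestLinear f A) x

/-- `C₁ = max_j max (V_HK(g), V_HK(x_j g))`, `j = 1, …, p`. -/
noncomputable def C₁ (h : p₀ ≤ p) (g : (Fin p₀ → ℝ) → ℝ) : ℝ≥0∞ :=
  max (hkVariation g) (⨆ j : Fin p, hkVariation fun x : Fin p → ℝ => x j * liftFun h g x)

/-- `C₂ = max |f|`. -/
noncomputable def C₂ (f : (Fin p → ℝ) → ℝ) : ℝ≥0∞ := cubeSup f

/-- `C₃`: the largest absolute residual for the true submodel. -/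
noncomputable def C₃ (h : p₀ ≤ p) (f : (Fin p → ℝ) → ℝ) (g : (Fin p₀ → ℝ) → ℝ) : ℝ≥0∞ :=
  cubeSup (residual h f g (trueModel p₀ p))

/-- `C₄`: the largest absolute residual over the submodels of size `M` missing a true variable. -/
noncomputable def C₄ (M : ℕ) (h : p₀ ≤ p) (f : (Fin p → ℝ) → ℝ) (g : (Fin p₀ → ℝ) → ℝ) : ℝ≥0∞ :=
  ⨆ A ∈ badModels p₀ M p, cubeSup (residual h f g A)

/-- `V₁`: the Hardy-Krause variation of the residual for the true submodel. -/
noncomputable def V₁ (h : p₀ ≤ p) (f : (Fin p → ℝ) → ℝ) (g : (Fin p₀ → ℝ) → ℝ) : ℝ≥0∞ :=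
  hkVariation (residual h f g (trueModel p₀ p))

/-- `V₂`: the largest Hardy-Krause variation of the residual over the submodels of size `M` missing
a true variable. -/
noncomputable def V₂ (M : ℕ) (h : p₀ ≤ p) (f : (Fin p → ℝ) → ℝ) (g : (Fin p₀ → ℝ) → ℝ) : ℝ≥0∞ :=
  ⨆ A ∈ badModels p₀ M p, hkVariation (residual h f g A)

end Growth

section LeastSquares

variable {n p : ℕ}

/-- The matrix `(1_n  X_A)`; the index `none` is the intercept. -/
def designMatrix (X : Matrix (Fin n) (Fin p) ℝ) (A : Finset (Fin p)) :
    Matrix (Fin n) (Option A) ℝ :=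
  Matrix.of fun i k => k.elim 1 fun j => X i j

/-- The least squares coefficients
`((1_n X_A)'(1_n X_A))⁻¹ (1_n X_A)' y` for the submodel `A`. -/
noncomputable def lsCoef (X : Matrix (Fin n) (Fin p) ℝ) (y : Fin n → ℝ) (A : Finset (Fin p)) :
    Option A → ℝ :=
  Matrix.mulVec ((designMatrix X A).transpose * designMatrix X A)⁻¹
    (Matrix.mulVec (designMatrix X A).transpose y)

/-- The least squares estimates of the intercept and of the slope vector, the latter expanded by
zeros to length `p`. -/
noncomputable def lsEstimate (X : Matrix (Fin n) (Fin p) ℝ) (y : Fin n → ℝ) (A : Finset (Fin p)) :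
    ℝ × (Fin p → ℝ) :=
  (lsCoef X y A none, fun j => if h : j ∈ A then lsCoef X y A (some ⟨j, h⟩) else 0)

/-- The residual sum of squares `‖y - 1_n β̂₀(A) - X β̂(A)‖²` of the submodel `A`. -/
noncomputable def rss (X : Matrix (Fin n) (Fin p) ℝ) (y : Fin n → ℝ) (A : Finset (Fin p)) : ℝ :=
  ∑ i, (y i - affineFun (lsEstimate X y A) (X i)) ^ 2

/-- The largest residual sum of squares over the submodels of size `M` that contain the true one is
strictly smaller than the smallest one over those that do not. (Values in `[0, ∞]`, so that a
minimum over no submodels is `∞`.) -/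
def Separates (p₀ M : ℕ) (X : Matrix (Fin n) (Fin p) ℝ) (y : Fin n → ℝ) : Prop :=
  ((goodModels p₀ M p).sup fun A => ENNReal.ofReal (rss X y A)) <
    (badModels p₀ M p).inf fun A => ENNReal.ofReal (rss X y A)

end LeastSquares

end LinearScreening

open LinearScreening

/-! In `L²` of the cube the constant and the centred coordinates `x j - 1/2` are orthogonal, so the
best linear approximation on `A` is a truncated orthogonal expansion, and its error is `∫ f²` minus
one term per variable in `A`. That term is `12 (∫ (x j - 1/2) f)²`. For an active variable it
exceeds `12 τ²` by assumption. For an inactive one it is at most `3 η²`, because `x j - 1/2` is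
orthogonal to every function of the other coordinates and hence to the approximation of `f`. A bad
submodel therefore has a larger population error than the true one, by at least `12 τ² - 3 M η²`
(`population_gap`).

The gap passes to the sample on a single event, `MomentsClose`: all second moments of features and
population residuals are within `t` of their integrals. The Gram matrices of submodels of size at
most `M` are then close to diagonal and coercive, so least squares is well posed. Fitting on a bad
submodel can improve on its population residual by at most `t` per observation, while a good
submodel does at least as well as the population coefficients of the true one
(`MomentsClose.separates`).

The event is likely by Hoeffding's inequality and a union bound over `O(p ^ (M + 2))` moments
(`measure_not_momentsClose_le`). Squared residuals are `O(n ^ κ)` with `κ < γ₀`, so the exponent is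
of order `n ^ (1 - 2κ)`. It dominates `log p = O(n ^ γ₁₀)` because `1 - 2κ > 1 - 2γ₀ = γ₁₀`. -/

namespace LinearScreening

/-! ### Integration over the unit cube and its reflections -/

section Cube

variable {ι : Type*}

lemma isCompact_cube : IsCompact (cube ι) := isCompact_Icc

lemma cube_eq_pi : cube ι = Set.univ.pi fun _ => Set.Icc (0 : ℝ) 1 := by
  rw [cube, ← Set.pi_univ_Icc]; rfl

section Reflect

variable [DecidableEq ι]

/-- Reflection of the `j`-th coordinate of the cube. -/
def reflect (j : ι) (x : ι → ℝ) : ι → ℝ := fun i => if i = j then 1 - x i else x i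

lemma reflect_reflect (j : ι) (x : ι → ℝ) : reflect j (reflect j x) = x := by
  ext i; by_cases h : i = j <;> simp [reflect, h]

lemma measurable_reflect (j : ι) : Measurable (reflect j) := by
  refine measurable_pi_lambda _ fun i => ?_
  by_cases h : i = j
  · simp only [reflect, h, if_true]; fun_prop
  · simp only [reflect, h, if_false]; fun_prop

end Reflect

variable [Fintype ι]

lemma measurableSet_cube : MeasurableSet (cube ι) := measurableSet_Icc

lemma restrict_cube_eq_pi :
    (volume : Measure (ι → ℝ)).restrict (cube ι) =
      Measure.pi fun _ => (volume : Measure ℝ).restrict (Set.Icc (0 : ℝ) 1) := by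
  rw [cube_eq_pi, volume_pi, Measure.restrict_pi_pi]

instance isProbabilityMeasure_unitInterval :
    IsProbabilityMeasure ((volume : Measure ℝ).restrict (Set.Icc (0 : ℝ) 1)) :=
  ⟨by simp⟩

instance isProbabilityMeasure_cube :
    IsProbabilityMeasure ((volume : Measure (ι → ℝ)).restrict (cube ι)) := by
  rw [restrict_cube_eq_pi]; infer_instance

/-- A bound on the cube carries over to the integral. -/
lemma abs_integral_cube_le {h : (ι → ℝ) → ℝ} {B : ℝ} (hB : ∀ x ∈ cube ι, |h x| ≤ B) :
    |∫ x in cube ι, h x| ≤ B := by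
  have := norm_integral_le_of_norm_le_const (μ := volume.restrict (cube ι)) (f := h) (C := B)
    ((ae_restrict_iff' measurableSet_cube).2 (ae_of_all _ hB))
  simpa using this

lemma integral_centered_sq (j : ι) : ∫ x in cube ι, (x j - 1 / 2) * (x j - 1 / 2) = 1 / 12 := by
  rw [restrict_cube_eq_pi]
  have h := (measurePreserving_eval
    (fun _ : ι => (volume : Measure ℝ).restrict (Set.Icc (0 : ℝ) 1)) j)
  have h2 := integral_map
    (μ := Measure.pi fun _ : ι => (volume : Measure ℝ).restrict (Set.Icc (0 : ℝ) 1))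
    (f := fun t : ℝ => (t - 1 / 2) * (t - 1 / 2)) h.measurable.aemeasurable
    (by fun_prop)
  rw [h.map_eq] at h2
  refine h2.symm.trans ?_
  rw [integral_Icc_eq_integral_Ioc, ← intervalIntegral.integral_of_le zero_le_one]
  have : ∀ x ∈ Set.uIcc (0 : ℝ) 1, HasDerivAt (fun t : ℝ => (t - 1 / 2) ^ 3 / 3)
      ((x - 1 / 2) * (x - 1 / 2)) x := by
    intro x _
    exact ((((hasDerivAt_id x).sub_const (1 / 2)).pow 3).div_const 3).congr_deriv
      (by simp only [id]; push_cast; ring)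
  rw [intervalIntegral.integral_eq_sub_of_hasDerivAt this
    (Continuous.intervalIntegrable (by fun_prop) _ _)]
  norm_num

variable [DecidableEq ι]

lemma measurePreserving_reflect (j : ι) :
    MeasurePreserving (reflect j) (volume.restrict (cube ι)) (volume.restrict (cube ι)) := by
  have h1 : MeasurePreserving (fun t : ℝ => 1 - t) (volume.restrict (Set.Icc (0 : ℝ) 1))
      (volume.restrict (Set.Icc (0 : ℝ) 1)) := by
    have := (Measure.measurePreserving_sub_left (volume : Measure ℝ) 1).restrict_preimage
      (measurableSet_Icc (a := (0 : ℝ)) (b := 1))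
    simpa using this
  rw [restrict_cube_eq_pi]
  have := measurePreserving_pi (fun _ : ι => (volume : Measure ℝ).restrict (Set.Icc (0 : ℝ) 1))
    (fun _ : ι => (volume : Measure ℝ).restrict (Set.Icc (0 : ℝ) 1))
    (f := fun i t => if i = j then 1 - t else t) (fun i => by
      by_cases h : i = j
      · simpa [h] using h1
      · simp only [h, if_false]; exact MeasurePreserving.id _)
  exact this

/-- The reflection is an involution, hence a measurable equivalence, so the change of variables
requires neither measurability nor integrability of `h`. -/
lemma integral_reflect (j : ι) (h : (ι → ℝ) → ℝ) :
    ∫ x in cube ι, h (reflect j x) = ∫ x in cube ι, h x := by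
  let e : (ι → ℝ) ≃ᵐ (ι → ℝ) :=
    { toFun := reflect j, invFun := reflect j, left_inv := reflect_reflect j,
      right_inv := reflect_reflect j, measurable_toFun := measurable_reflect j,
      measurable_invFun := measurable_reflect j }
  exact (measurePreserving_reflect j).integral_comp e.measurableEmbedding h

/-- A centred coordinate is orthogonal to every function that does not depend on it. -/
lemma integral_centered_mul_eq_zero (j : ι) (h : (ι → ℝ) → ℝ)
    (hh : ∀ x, h (reflect j x) = h x) :
    ∫ x in cube ι, (x j - 1 / 2) * h x = 0 := by
  -- The factor `x j - 1/2` is odd under the reflection and `h` is even, so the integral equals its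
  -- own negative.
  have h1 := integral_reflect j fun x => (x j - 1 / 2) * h x
  have h2 : ∫ x in cube ι, (reflect j x j - 1 / 2) * h (reflect j x) =
      -∫ x in cube ι, (x j - 1 / 2) * h x := by
    rw [← integral_neg]
    congr 1; ext x; rw [hh]; simp [reflect]; ring
  rw [h2] at h1; linarith

end Cube

/-! ### Orthogonal features and the best linear approximation -/

section Features

variable {p : ℕ}

/-- The constant function (`none`) and the centred coordinates. -/
noncomputable def feature (k : Option (Fin p)) (x : Fin p → ℝ) : ℝ := k.elim 1 fun j => x j - 1 / 2

/-- The squared norms of the features. -/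
noncomputable def featureNorm (k : Option (Fin p)) : ℝ := k.elim 1 fun _ => 1 / 12

@[simp] lemma feature_none (x : Fin p → ℝ) : feature none x = 1 := rfl

@[simp] lemma feature_some (j : Fin p) (x : Fin p → ℝ) : feature (some j) x = x j - 1 / 2 := rfl

@[simp] lemma featureNorm_none : featureNorm (none : Option (Fin p)) = 1 := rfl

@[simp] lemma featureNorm_some (j : Fin p) : featureNorm (some j) = 1 / 12 := rfl

lemma featureNorm_ge (k : Option (Fin p)) : 1 / 12 ≤ featureNorm k := by
  cases k <;> norm_num

lemma featureNorm_pos (k : Option (Fin p)) : 0 < featureNorm k :=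
  lt_of_lt_of_le (by norm_num) (featureNorm_ge k)

lemma continuous_feature (k : Option (Fin p)) : Continuous (feature k) := by
  cases k
  · exact continuous_const
  · exact (continuous_apply _).sub continuous_const

lemma abs_feature_some_le (j : Fin p) {x : Fin p → ℝ} (hx : x ∈ cube (Fin p)) :
    |feature (some j) x| ≤ 1 / 2 := by
  have h0 := hx.1 j
  have h1 := hx.2 j
  simp only [Pi.zero_apply, Pi.one_apply] at h0 h1
  rw [feature_some, abs_le]; constructor <;> linarith

lemma abs_feature_le_one (k : Option (Fin p)) {x : Fin p → ℝ} (hx : x ∈ cube (Fin p)) :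
    |feature k x| ≤ 1 := by
  cases k with
  | none => simp
  | some j => exact (abs_feature_some_le j hx).trans (by norm_num)

lemma integral_feature_mul_feature (k l : Option (Fin p)) :
    ∫ x in cube (Fin p), feature k x * feature l x = if k = l then featureNorm k else 0 := by
  cases k with
  | none =>
    cases l with
    | none => simp
    | some j =>
      have := integral_centered_mul_eq_zero j (fun _ : Fin p → ℝ => (1 : ℝ)) (fun _ => rfl)
      simpa using this
  | some i =>
    by_cases h : some i = l
    · subst h
      simpa using integral_centered_sq i
    · rw [if_neg h]
      refine integral_centered_mul_eq_zero i (feature l) fun x => ?_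
      cases l with
      | none => rfl
      | some j =>
        have : j ≠ i := fun e => h (by rw [e])
        simp [reflect, this]

lemma integrableOn_cube {h : (Fin p → ℝ) → ℝ} (hh : ContinuousOn h (cube (Fin p))) :
    IntegrableOn h (cube (Fin p)) :=
  hh.integrableOn_compact isCompact_cube

/-- The coefficients of the best linear approximation in the basis of the features. -/
noncomputable def featureCoef (f : (Fin p → ℝ) → ℝ) (k : Option (Fin p)) : ℝ :=
  (∫ x in cube (Fin p), feature k x * f x) / featureNorm k

/-- The error of the best linear approximation based on the variables in `A`. -/
noncomputable def populationResidual (f : (Fin p → ℝ) → ℝ) (A : Finset (Fin p))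
    (x : Fin p → ℝ) : ℝ :=
  f x - ∑ k ∈ A.insertNone, featureCoef f k * feature k x

lemma continuousOn_populationResidual {f : (Fin p → ℝ) → ℝ} (hf : ContinuousOn f (cube (Fin p)))
    (A : Finset (Fin p)) : ContinuousOn (populationResidual f A) (cube (Fin p)) :=
  hf.sub (continuous_finsetSum _ fun k _ =>
    continuous_const.mul (continuous_feature k)).continuousOn

lemma integral_sum_feature_mul {f : (Fin p → ℝ) → ℝ} (hf : ContinuousOn f (cube (Fin p)))
    (S : Finset (Option (Fin p))) (d : Option (Fin p) → ℝ) :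
    ∫ x in cube (Fin p), (∑ k ∈ S, d k * feature k x) * f x =
      ∑ k ∈ S, d k * (featureNorm k * featureCoef f k) := by
  simp_rw [Finset.sum_mul, mul_assoc]
  rw [integral_finsetSum]
  · refine Finset.sum_congr rfl fun k _ => ?_
    rw [integral_const_mul, featureCoef, mul_div_cancel₀ _ (featureNorm_pos k).ne']
  · intro k _
    exact integrableOn_cube (continuousOn_const.mul ((continuous_feature k).continuousOn.mul hf))

lemma featureCoef_sum (S : Finset (Option (Fin p))) (d : Option (Fin p) → ℝ)
    {k : Option (Fin p)} (hk : k ∈ S) :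
    featureCoef (fun x => ∑ l ∈ S, d l * feature l x) k = d k := by
  rw [featureCoef]
  simp_rw [Finset.mul_sum, mul_left_comm (feature k _)]
  rw [integral_finsetSum]
  · simp_rw [integral_const_mul, integral_feature_mul_feature]
    simp [Finset.sum_ite_eq, hk, (featureNorm_pos k).ne']
  · intro l _
    exact integrableOn_cube (continuous_const.mul
      ((continuous_feature k).mul (continuous_feature l))).continuousOn

/-- The Pythagorean theorem for linear approximation. -/
lemma integral_sub_sum_feature_sq {f : (Fin p → ℝ) → ℝ} (hf : ContinuousOn f (cube (Fin p)))
    (S : Finset (Option (Fin p))) (d : Option (Fin p) → ℝ) :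
    ∫ x in cube (Fin p), (f x - ∑ k ∈ S, d k * feature k x) ^ 2 =
      (∫ x in cube (Fin p), f x ^ 2) - ∑ k ∈ S, featureNorm k * featureCoef f k ^ 2 +
        ∑ k ∈ S, featureNorm k * (d k - featureCoef f k) ^ 2 := by
  have hs : Continuous fun x : Fin p → ℝ => ∑ k ∈ S, d k * feature k x :=
    continuous_finsetSum _ fun k _ => continuous_const.mul (continuous_feature k)
  have h1 : ∀ x, (f x - ∑ k ∈ S, d k * feature k x) ^ 2 =
      f x ^ 2 - 2 * ((∑ k ∈ S, d k * feature k x) * f x) +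
        (∑ k ∈ S, d k * feature k x) * (∑ k ∈ S, d k * feature k x) := fun x => by ring
  simp_rw [h1]
  rw [integral_add, integral_sub, integral_const_mul, integral_sum_feature_mul hf,
    integral_sum_feature_mul hs.continuousOn]
  · rw [Finset.sum_congr (s₂ := S) (f := fun k => d k * (featureNorm k *
        featureCoef (fun x => ∑ l ∈ S, d l * feature l x) k)) (g := fun k => d k *
        (featureNorm k * d k)) rfl fun k hk => by rw [featureCoef_sum S d hk], Finset.mul_sum,
      sub_add, sub_add, ← Finset.sum_sub_distrib, ← Finset.sum_sub_distrib]
    congr 1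
    exact Finset.sum_congr rfl fun k _ => by ring
  · exact integrableOn_cube (hf.pow 2)
  · exact integrableOn_cube (continuousOn_const.mul (hs.continuousOn.mul hf))
  · exact integrableOn_cube ((hf.pow 2).sub (continuousOn_const.mul (hs.continuousOn.mul hf)))
  · exact integrableOn_cube (hs.continuousOn.mul hs.continuousOn)

lemma integral_populationResidual_sq {f : (Fin p → ℝ) → ℝ} (hf : ContinuousOn f (cube (Fin p)))
    (A : Finset (Fin p)) :
    ∫ x in cube (Fin p), populationResidual f A x ^ 2 =
      (∫ x in cube (Fin p), f x ^ 2) -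
        ∑ k ∈ A.insertNone, featureNorm k * featureCoef f k ^ 2 := by
  simp only [populationResidual]
  rw [integral_sub_sum_feature_sq hf]
  simp

lemma integral_feature_mul_populationResidual {f : (Fin p → ℝ) → ℝ}
    (hf : ContinuousOn f (cube (Fin p))) (A : Finset (Fin p)) {k : Option (Fin p)}
    (hk : k ∈ A.insertNone) :
    ∫ x in cube (Fin p), feature k x * populationResidual f A x = 0 := by
  have hs : Continuous fun x : Fin p → ℝ => ∑ k ∈ A.insertNone, featureCoef f k * feature k x :=
    continuous_finsetSum _ fun k _ => continuous_const.mul (continuous_feature k)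
  simp only [populationResidual, mul_sub]
  have h1 : IntegrableOn (fun x => feature k x * f x) (cube (Fin p)) :=
    integrableOn_cube ((continuous_feature k).continuousOn.mul hf)
  have h2 : IntegrableOn (fun x => feature k x *
      ∑ k ∈ A.insertNone, featureCoef f k * feature k x) (cube (Fin p)) :=
    integrableOn_cube ((continuous_feature k).mul hs).continuousOn
  rw [integral_sub h1 h2, sub_eq_zero]
  have := featureCoef_sum A.insertNone (featureCoef f) hk
  rw [featureCoef, featureCoef, div_left_inj' (featureNorm_pos k).ne'] at this
  exact this.symm

/-- The coefficients of an affine function in the basis of the features. -/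
noncomputable def centeredCoef (c : ℝ × (Fin p → ℝ)) (k : Option (Fin p)) : ℝ :=
  k.elim (c.1 + 1 / 2 * ∑ j, c.2 j) c.2

lemma affineFun_eq_sum_feature {A : Finset (Fin p)} {c : ℝ × (Fin p → ℝ)}
    (hc : ∀ j ∉ A, c.2 j = 0) (x : Fin p → ℝ) :
    affineFun c x = ∑ k ∈ A.insertNone, centeredCoef c k * feature k x := by
  rw [Finset.sum_insertNone]
  have h1 : ∑ j, c.2 j = ∑ j ∈ A, c.2 j :=
    (Finset.sum_subset A.subset_univ fun j _ hj => hc j hj).symm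
  have h2 : ∑ j, c.2 j * x j = ∑ j ∈ A, c.2 j * x j :=
    (Finset.sum_subset A.subset_univ fun j _ hj => by rw [hc j hj, zero_mul]).symm
  simp only [affineFun, centeredCoef, Option.elim, feature_none, feature_some, h1, h2, mul_sub,
    Finset.sum_sub_distrib, ← Finset.sum_mul]
  ring

lemma meanSqError_eq {f : (Fin p → ℝ) → ℝ} (hf : ContinuousOn f (cube (Fin p)))
    {A : Finset (Fin p)} {c : ℝ × (Fin p → ℝ)} (hc : ∀ j ∉ A, c.2 j = 0) :
    meanSqError f c = (∫ x in cube (Fin p), f x ^ 2) -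
        (∑ k ∈ A.insertNone, featureNorm k * featureCoef f k ^ 2) +
        ∑ k ∈ A.insertNone, featureNorm k * (centeredCoef c k - featureCoef f k) ^ 2 := by
  rw [meanSqError, ← integral_sub_sum_feature_sq hf]
  simp_rw [affineFun_eq_sum_feature hc]

/-- In centred coordinates the error is a constant plus a positive diagonal quadratic form, by
`meanSqError_eq`. Existence of a minimizer makes the choice in `bestLinear` meaningful, and
positivity of the weights forces its centred coefficients to be those of the expansion. -/
lemma isBestLinear_bestLinear {f : (Fin p → ℝ) → ℝ} (hf : ContinuousOn f (cube (Fin p)))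
    (A : Finset (Fin p)) :
    IsBestLinear f A (bestLinear f A) ∧
      ∀ k ∈ A.insertNone, centeredCoef (bestLinear f A) k = featureCoef f k := by
  classical
  let s : Fin p → ℝ := fun j => if j ∈ A then featureCoef f (some j) else 0
  -- The intercept is shifted to undo the centring of the coordinates.
  let c : ℝ × (Fin p → ℝ) := (featureCoef f none - 1 / 2 * ∑ j, s j, s)
  have hcA : ∀ j ∉ A, c.2 j = 0 := fun j hj => if_neg hj
  have hc : ∀ k ∈ A.insertNone, centeredCoef c k = featureCoef f k := by
    intro k hk
    cases k with
    | none => simp [centeredCoef, c]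
    | some j =>
      have : j ∈ A := by simpa using hk
      simp [centeredCoef, c, s, this]
  have hc0 : ∑ k ∈ A.insertNone, featureNorm k * (centeredCoef c k - featureCoef f k) ^ 2 = 0 :=
    Finset.sum_eq_zero fun k hk => by rw [hc k hk]; ring
  have hnn : ∀ (c : ℝ × (Fin p → ℝ)), ∀ k ∈ A.insertNone,
      0 ≤ featureNorm k * (centeredCoef c k - featureCoef f k) ^ 2 :=
    fun c k _ => mul_nonneg (featureNorm_pos k).le (sq_nonneg _)
  have hbest : IsBestLinear f A (bestLinear f A) := by
    refine Classical.epsilon_spec (p := IsBestLinear f A) ⟨c, hcA, fun c' hc' => ?_⟩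
    rw [meanSqError_eq hf hcA, meanSqError_eq hf hc', hc0]
    linarith [Finset.sum_nonneg (hnn c')]
  refine ⟨hbest, fun k hk => ?_⟩
  have h := hbest.2 c hcA
  rw [meanSqError_eq hf hcA, meanSqError_eq hf hbest.1, hc0] at h
  have h0 := (Finset.sum_eq_zero_iff_of_nonneg (hnn (bestLinear f A))).1
    (le_antisymm (by linarith) (Finset.sum_nonneg (hnn _))) k hk
  have := (mul_eq_zero.1 h0).resolve_left (featureNorm_pos k).ne'
  linarith [pow_eq_zero_iff (two_ne_zero) |>.1 this]

lemma affineFun_bestLinear {f : (Fin p → ℝ) → ℝ} (hf : ContinuousOn f (cube (Fin p)))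
    (A : Finset (Fin p)) (x : Fin p → ℝ) :
    affineFun (bestLinear f A) x = ∑ k ∈ A.insertNone, featureCoef f k * feature k x := by
  obtain ⟨h1, h2⟩ := isBestLinear_bestLinear hf A
  rw [affineFun_eq_sum_feature h1.1]
  exact Finset.sum_congr rfl fun k hk => by rw [h2 k hk]

lemma populationResidual_eq {f : (Fin p → ℝ) → ℝ} (hf : ContinuousOn f (cube (Fin p)))
    (A : Finset (Fin p)) (x : Fin p → ℝ) :
    populationResidual f A x = f x - affineFun (bestLinear f A) x := by
  rw [affineFun_bestLinear hf, populationResidual]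

end Features

/-! ### Nearly diagonal quadratic forms and empirical means -/

section QuadraticForms

variable {K : Type*}

lemma sq_sum_abs_le (S : Finset K) (d : K → ℝ) :
    (∑ k ∈ S, |d k|) ^ 2 ≤ S.card * ∑ k ∈ S, d k ^ 2 := by
  simpa using sq_sum_le_card_mul_sum_sq (s := S) (f := fun k => |d k|)

/-- The empirical mean of `h` over the points `x₁, …, xₙ`. -/
noncomputable def empMean {n : ℕ} {α : Type*} (x : Fin n → α) (h : α → ℝ) : ℝ :=
  (∑ i, h (x i)) / n

variable {n : ℕ} {α : Type*}

lemma empMean_sum_mul_sum (x : Fin n → α) (z : K → α → ℝ) (S : Finset K) (d : K → ℝ) :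
    empMean x (fun a => (∑ k ∈ S, d k * z k a) ^ 2) =
      ∑ k ∈ S, ∑ l ∈ S, d k * d l * empMean x fun a => z k a * z l a := by
  have h (i : Fin n) : (∑ k ∈ S, d k * z k (x i)) ^ 2 =
      ∑ k ∈ S, ∑ l ∈ S, d k * d l * (z k (x i) * z l (x i)) := by
    rw [sq, Finset.sum_mul_sum]
    exact Finset.sum_congr rfl fun k _ => Finset.sum_congr rfl fun l _ => by ring
  simp only [empMean, h, mul_div_assoc', Finset.mul_sum, ← Finset.sum_div]
  rw [Finset.sum_comm]
  congr 1
  exact Finset.sum_congr rfl fun k _ => Finset.sum_comm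

lemma empMean_sub_sum_sq (x : Fin n → α) (r : α → ℝ) (z : K → α → ℝ) (S : Finset K) (d : K → ℝ) :
    empMean x (fun a => (r a - ∑ k ∈ S, d k * z k a) ^ 2) =
      empMean x (fun a => r a * r a) - 2 * (∑ k ∈ S, d k * empMean x fun a => z k a * r a) +
        empMean x fun a => (∑ k ∈ S, d k * z k a) ^ 2 := by
  have h1 : ∑ k ∈ S, d k * empMean x (fun a => z k a * r a) =
      (∑ i, (∑ k ∈ S, d k * z k (x i)) * r (x i)) / n := by
    simp only [empMean, mul_div_assoc', Finset.mul_sum, ← Finset.sum_div, Finset.sum_mul]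
    rw [Finset.sum_comm]
    simp only [mul_assoc]
  rw [h1]
  simp only [empMean, mul_div_assoc', ← sub_div, ← add_div]
  rw [Finset.mul_sum (s := Finset.univ), ← Finset.sum_sub_distrib, ← Finset.sum_add_distrib]
  congr 1
  exact Finset.sum_congr rfl fun i _ => by ring

variable [DecidableEq K]

/-- A quadratic form whose matrix is entrywise close to a diagonal one with diagonal entries at
least `1 / 12` is coercive. -/
lemma le_quadratic_of_close_to_diagonal (S : Finset K) (G : K → K → ℝ) (w d : K → ℝ) {ε : ℝ}
    (hε : 0 ≤ ε) (hw : ∀ k ∈ S, 1 / 12 ≤ w k)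
    (hG : ∀ k ∈ S, ∀ l ∈ S, |G k l - if k = l then w k else 0| ≤ ε)
    (hS : ε * S.card ≤ 1 / 24) :
    1 / 24 * ∑ k ∈ S, d k ^ 2 ≤ ∑ k ∈ S, ∑ l ∈ S, d k * d l * G k l := by
  have hsq : 0 ≤ ∑ k ∈ S, d k ^ 2 := Finset.sum_nonneg fun k _ => sq_nonneg _
  -- Diagonal part plus perturbation: the former gives `1/12`, and Cauchy–Schwarz with `hS` lets the
  -- latter consume at most half of it.
  have h1 : ∑ k ∈ S, ∑ l ∈ S, d k * d l * G k l = ∑ k ∈ S, w k * d k ^ 2 +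
      ∑ k ∈ S, ∑ l ∈ S, d k * d l * (G k l - if k = l then w k else 0) := by
    rw [← Finset.sum_add_distrib]
    refine Finset.sum_congr rfl fun k hk => ?_
    simp_rw [mul_sub]
    rw [Finset.sum_sub_distrib]
    simp only [mul_ite, mul_zero, Finset.sum_ite_eq, hk, if_true]
    ring
  have h2 : 1 / 12 * ∑ k ∈ S, d k ^ 2 ≤ ∑ k ∈ S, w k * d k ^ 2 := by
    rw [Finset.mul_sum]
    exact Finset.sum_le_sum fun k hk => mul_le_mul_of_nonneg_right (hw k hk) (sq_nonneg _)
  have h3 : |∑ k ∈ S, ∑ l ∈ S, d k * d l * (G k l - if k = l then w k else 0)| ≤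
      ε * (∑ k ∈ S, |d k|) ^ 2 := by
    rw [sq, Finset.sum_mul_sum, Finset.mul_sum]
    refine (Finset.abs_sum_le_sum_abs _ _).trans (Finset.sum_le_sum fun k hk => ?_)
    rw [Finset.mul_sum]
    refine (Finset.abs_sum_le_sum_abs _ _).trans (Finset.sum_le_sum fun l hl => ?_)
    rw [abs_mul, abs_mul, mul_comm]
    exact mul_le_mul_of_nonneg_right (hG k hk l hl) (by positivity)
  have h4 : ε * (∑ k ∈ S, |d k|) ^ 2 ≤ 1 / 24 * ∑ k ∈ S, d k ^ 2 := by
    calc ε * (∑ k ∈ S, |d k|) ^ 2 ≤ ε * (S.card * ∑ k ∈ S, d k ^ 2) :=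
          mul_le_mul_of_nonneg_left (sq_sum_abs_le S d) hε
      _ = (ε * S.card) * ∑ k ∈ S, d k ^ 2 := by ring
      _ ≤ _ := mul_le_mul_of_nonneg_right hS hsq
  have := (abs_le.1 h3).1
  linarith

/-- If the features are empirically nearly orthogonal to each other and to `r`, then no combination
of them approximates `r` much better than zero does. -/
lemma le_empMean_sub_sum_sq (x : Fin n → α) (r : α → ℝ) (z : K → α → ℝ) (S : Finset K)
    (w d : K → ℝ) {ε : ℝ} (hε : 0 ≤ ε) (hw : ∀ k ∈ S, 1 / 12 ≤ w k)
    (hG : ∀ k ∈ S, ∀ l ∈ S,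
      |empMean x (fun a => z k a * z l a) - if k = l then w k else 0| ≤ ε)
    (hr : ∀ k ∈ S, |empMean x fun a => z k a * r a| ≤ ε)
    (hS : ε * S.card ≤ 1 / 24) :
    empMean x (fun a => r a * r a) - ε ≤
      empMean x fun a => (r a - ∑ k ∈ S, d k * z k a) ^ 2 := by
  have h1 := le_quadratic_of_close_to_diagonal S (fun k l => empMean x fun a => z k a * z l a)
    w d hε hw hG hS
  rw [empMean_sub_sum_sq, empMean_sum_mul_sum]
  have h2 : 2 * (∑ k ∈ S, d k * empMean x fun a => z k a * r a) ≤
      ∑ k ∈ S, (1 / 24 * d k ^ 2 + 24 * ε ^ 2) := by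
    rw [Finset.mul_sum]
    refine Finset.sum_le_sum fun k hk => ?_
    -- Young's inequality, weighted so that the quadratic term is exactly what the coercivity
    -- constant `1/24` absorbs.
    have h3 := sq_nonneg (d k - 24 * empMean x fun a => z k a * r a)
    have h4 : (empMean x fun a => z k a * r a) ^ 2 ≤ ε ^ 2 := sq_le_sq' (abs_le.1 (hr k hk)).1
      (abs_le.1 (hr k hk)).2
    nlinarith
  rw [Finset.sum_add_distrib, ← Finset.mul_sum, Finset.sum_const, nsmul_eq_mul] at h2
  have h5 : (S.card : ℝ) * (24 * ε ^ 2) ≤ ε := by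
    calc (S.card : ℝ) * (24 * ε ^ 2) = 24 * ε * (ε * S.card) := by ring
      _ ≤ 24 * ε * (1 / 24) := mul_le_mul_of_nonneg_left hS (by positivity)
      _ = ε := by ring
  linarith

end QuadraticForms

/-! ### Least squares as minimization -/

section LeastSquares

variable {n p : ℕ} (X : Matrix (Fin n) (Fin p) ℝ) (y : Fin n → ℝ) (A : Finset (Fin p))

/-- A coefficient vector of the submodel `A`, expanded by zeros. -/
noncomputable def expandCoef {p : ℕ} (A : Finset (Fin p)) (v : Option A → ℝ) :
    ℝ × (Fin p → ℝ) :=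
  (v none, fun j => if h : j ∈ A then v (some ⟨j, h⟩) else 0)

lemma expandCoef_of_notMem {p : ℕ} {A : Finset (Fin p)} (v : Option A → ℝ) :
    ∀ j ∉ A, (expandCoef A v).2 j = 0 := fun _ hj => dif_neg hj

lemma affineFun_expandCoef (v : Option A → ℝ) (i : Fin n) :
    affineFun (expandCoef A v) (X i) = (designMatrix X A).mulVec v i := by
  have h : ∑ j, (expandCoef A v).2 j * X i j = ∑ j ∈ A, (expandCoef A v).2 j * X i j :=
    (Finset.sum_subset A.subset_univ fun j _ hj => by
      rw [expandCoef_of_notMem v j hj, zero_mul]).symm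
  rw [affineFun, h, ← Finset.sum_coe_sort A]
  simp [Matrix.mulVec, dotProduct, designMatrix, Fintype.sum_option, expandCoef, mul_comm]

lemma exists_eq_expandCoef {c : ℝ × (Fin p → ℝ)} (hc : ∀ j ∉ A, c.2 j = 0) :
    ∃ v, c = expandCoef A v := by
  refine ⟨fun k => k.elim c.1 fun j => c.2 j, Prod.ext rfl (funext fun j => ?_)⟩
  by_cases h : j ∈ A <;> simp [expandCoef, h]
  exact hc j h

/-- The least squares estimate minimizes the residual sum of squares, provided that the design
matrix has full column rank. -/
lemma rss_le (hX : ∀ v, (designMatrix X A).mulVec v = 0 → v = 0)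
    {c : ℝ × (Fin p → ℝ)} (hc : ∀ j ∉ A, c.2 j = 0) :
    rss X y A ≤ ∑ i, (y i - affineFun c (X i)) ^ 2 := by
  obtain ⟨v, rfl⟩ := exists_eq_expandCoef A hc
  set D := designMatrix X A with hD
  set b := lsCoef X y A with hb
  have hunit : IsUnit (D.transpose * D) := by
    rw [← Matrix.mulVec_injective_iff_isUnit]
    refine (injective_iff_map_eq_zero (Matrix.mulVecLin (D.transpose * D))).2 fun u hu => hX u ?_
    have h1 : dotProduct (D.mulVec u) (D.mulVec u) = 0 := by
      rw [Matrix.dotProduct_mulVec, Matrix.vecMul_mulVec, ← Matrix.mulVec_transpose]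
      simp only [Matrix.mulVecLin_apply] at hu
      simp [Matrix.transpose_mul, hu]
    exact dotProduct_self_eq_zero.1 h1
  have hnormal : D.transpose.mulVec (D.mulVec b) = D.transpose.mulVec y := by
    rw [Matrix.mulVec_mulVec, hb, lsCoef, Matrix.mulVec_mulVec, ← hD,
      Matrix.mul_nonsing_inv _ ((Matrix.isUnit_iff_isUnit_det _).1 hunit), Matrix.one_mulVec]
  have horth : dotProduct (D.mulVec (b - v)) (y - D.mulVec b) = 0 := by
    rw [dotProduct_comm, Matrix.dotProduct_mulVec, ← Matrix.mulVec_transpose, Matrix.mulVec_sub,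
      hnormal, sub_self, zero_dotProduct]
  have hrss : rss X y A = ∑ i, (y i - D.mulVec b i) ^ 2 := by
    simp only [rss]
    exact Finset.sum_congr rfl fun i _ => by rw [← affineFun_expandCoef]; rfl
  simp_rw [hrss, affineFun_expandCoef, ← hD]
  have h2 : ∀ i, (y i - D.mulVec v i) ^ 2 = (y i - D.mulVec b i) ^ 2 +
      2 * (D.mulVec (b - v) i * (y - D.mulVec b) i) + (D.mulVec (b - v) i) ^ 2 := fun i => by
    simp only [Matrix.mulVec_sub, Pi.sub_apply]; ring
  simp_rw [h2]
  rw [Finset.sum_add_distrib, Finset.sum_add_distrib, ← Finset.mul_sum]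
  have h3 : ∑ i, D.mulVec (b - v) i * (y - D.mulVec b) i = 0 := horth
  rw [h3]
  have := Finset.sum_nonneg fun i (_ : i ∈ Finset.univ) => sq_nonneg (D.mulVec (b - v) i)
  linarith

end LeastSquares

/-! ### From close moments to separation of the submodels -/

section Separation

variable {n p p₀ M : ℕ}

/-- The features together with the population residual of the submodel `A` (`none`). -/
noncomputable def residualAndFeatures (f : (Fin p → ℝ) → ℝ) (A : Finset (Fin p))
    (a : Option (Option (Fin p))) : (Fin p → ℝ) → ℝ :=
  a.elim (populationResidual f A) feature

/-- The submodels whose population residuals matter: the true one and the bad ones. -/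
def relevantModels (p₀ M p : ℕ) : Finset (Finset (Fin p)) :=
  insert (trueModel p₀ p) (badModels p₀ M p)

/-- The empirical second moments of the features and the population residuals are within `t` of
their population counterparts. -/
def MomentsClose (p₀ M : ℕ) (f : (Fin p → ℝ) → ℝ) (t : ℝ) (X : Matrix (Fin n) (Fin p) ℝ) : Prop :=
  ∀ A ∈ relevantModels p₀ M p, ∀ a b,
    |empMean X.row (fun x => residualAndFeatures f A a x * residualAndFeatures f A b x) -
      ∫ x in cube (Fin p), residualAndFeatures f A a x * residualAndFeatures f A b x| ≤ t

lemma card_of_mem_badModels {A : Finset (Fin p)} (hA : A ∈ badModels p₀ M p) : A.card = M := by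
  simp only [badModels, Finset.mem_filter] at hA
  exact hA.2.1

variable {f : (Fin p → ℝ) → ℝ} {t : ℝ} {X : Matrix (Fin n) (Fin p) ℝ}

lemma MomentsClose.gram (h : MomentsClose p₀ M f t X) (k l : Option (Fin p)) :
    |empMean X.row (fun x => feature k x * feature l x) - if k = l then featureNorm k else 0| ≤ t := by
  -- Moments of features do not involve the submodel; the true one is always available as an
  -- instance.
  have := h _ (Finset.mem_insert_self _ _) (some k) (some l)
  simpa only [residualAndFeatures, Option.elim, integral_feature_mul_feature] using this

lemma MomentsClose.residual (h : MomentsClose p₀ M f t X) {A : Finset (Fin p)}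
    (hA : A ∈ relevantModels p₀ M p) :
    |empMean X.row (fun x => populationResidual f A x * populationResidual f A x) -
      ∫ x in cube (Fin p), populationResidual f A x ^ 2| ≤ t := by
  have := h _ hA none none
  simpa only [residualAndFeatures, Option.elim, sq] using this

/-- A coefficient vector in the kernel annihilates the empirical quadratic form, which is coercive
in the centred coefficients. -/
lemma MomentsClose.mulVec_injective (h : MomentsClose p₀ M f t X) (ht : 0 ≤ t)
    {A : Finset (Fin p)} (hA : t * (A.card + 1) ≤ 1 / 24) (v : Option A → ℝ)
    (hv : (designMatrix X A).mulVec v = 0) : v = 0 := by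
  have hsupp := expandCoef_of_notMem v
  set d := centeredCoef (expandCoef A v)
  have h1 := le_quadratic_of_close_to_diagonal A.insertNone
    (fun k l => empMean X.row fun x => feature k x * feature l x) featureNorm d ht
    (fun k _ => featureNorm_ge k) (fun k _ l _ => h.gram k l)
    (by simpa [Finset.card_insertNone] using hA)
  have h2 : empMean X.row (fun x => (∑ k ∈ A.insertNone, d k * feature k x) ^ 2) = 0 := by
    have h3 (i : Fin n) : ∑ k ∈ A.insertNone, d k * feature k (X.row i) = 0 :=
      (affineFun_eq_sum_feature hsupp _).symm.trans
        ((affineFun_expandCoef X A v i).trans (congrFun hv i))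
    simp [empMean, h3]
  rw [← empMean_sum_mul_sum, h2] at h1
  have h3 : ∑ k ∈ A.insertNone, d k ^ 2 = 0 :=
    le_antisymm (by linarith) (Finset.sum_nonneg fun k _ => sq_nonneg _)
  have h4 : ∀ k ∈ A.insertNone, d k = 0 := fun k hk => by
    simpa using (Finset.sum_eq_zero_iff_of_nonneg fun k _ => sq_nonneg _).1 h3 k hk
  have h5 : ∀ j, (expandCoef A v).2 j = 0 := fun j => by
    by_cases hj : j ∈ A
    · exact h4 (some j) (by simpa using hj)
    · exact hsupp j hj
  funext k
  cases k with
  | none =>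
    have := h4 none (by simp)
    have h6 : (expandCoef A v).1 = 0 := by simpa [d, centeredCoef, h5] using this
    exact h6
  | some j => simpa [expandCoef] using h5 j

/-- Closeness of the moments together with a gap between the population errors yields separation. -/
lemma MomentsClose.separates (h : MomentsClose p₀ M f t X) (hf : ContinuousOn f (cube (Fin p)))
    (hn : 0 < n) (ht : 0 < t) (htM : t * (M + 1) ≤ 1 / 24)
    (hgap : ∀ A ∈ badModels p₀ M p,
      (∫ x in cube (Fin p), populationResidual f (trueModel p₀ p) x ^ 2) + 4 * t ≤
        ∫ x in cube (Fin p), populationResidual f A x ^ 2) :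
    Separates p₀ M X fun i => f (X i) := by
  set L := ∫ x in cube (Fin p), populationResidual f (trueModel p₀ p) x ^ 2 with hL
  have hn' : (0 : ℝ) < n := Nat.cast_pos.2 hn
  have hL0 : 0 ≤ L := integral_nonneg fun x => sq_nonneg _
  have hgood : ∀ A ∈ goodModels p₀ M p, rss X (fun i => f (X i)) A ≤ n * (L + t) := by
    intro A hA
    simp only [goodModels, Finset.mem_filter, Finset.mem_univ, true_and] at hA
    -- The population coefficients of the true submodel are admissible for every good `A`, so one
    -- residual controls all good submodels at once.
    have hc : ∀ j ∉ A, (bestLinear f (trueModel p₀ p)).2 j = 0 := fun j hj =>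
      (isBestLinear_bestLinear hf _).1.1 j fun hj' => hj (hA.2 hj')
    refine (rss_le X _ A (h.mulVec_injective ht.le (by rwa [hA.1])) hc).trans ?_
    have h1 := (abs_le.1 (h.residual (Finset.mem_insert_self _ _))).2
    rw [← hL, empMean, sub_le_iff_le_add, div_le_iff₀ hn'] at h1
    simp_rw [populationResidual_eq hf, ← sq] at h1
    rw [add_comm L, mul_comm]
    exact h1
  have hbad : ∀ A ∈ badModels p₀ M p, n * (L + 2 * t) ≤ rss X (fun i => f (X i)) A := by
    intro A hA
    have hA' : A ∈ relevantModels p₀ M p := Finset.mem_insert_of_mem hA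
    set c := lsEstimate X (fun i => f (X i)) A
    have hcA : ∀ j ∉ A, c.2 j = 0 := expandCoef_of_notMem (lsCoef X (fun i => f (X i)) A)
    have h1 := (abs_le.1 (h.residual hA')).1
    have h2 := le_empMean_sub_sum_sq X.row (populationResidual f A) feature A.insertNone featureNorm
      (fun k => centeredCoef c k - featureCoef f k) ht.le (fun k _ => featureNorm_ge k)
      (fun k _ l _ => h.gram k l) (fun k hk => by
        have := h _ hA' (some k) none
        simpa only [residualAndFeatures, Option.elim,
          integral_feature_mul_populationResidual hf A hk, sub_zero] using this)
      (by simpa [Finset.card_insertNone, card_of_mem_badModels hA] using htM)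
    -- Any affine fit on `A` leaves the population residual minus a combination of the features of
    -- `A`. The lower bound thus holds for all coefficients supported in `A`. It loses `t` to the
    -- fit and `t` to the moment of the residual, so `2 t` of the gap `4 t` remains.
    have h3 : ∀ x, populationResidual f A x - ∑ k ∈ A.insertNone,
        (centeredCoef c k - featureCoef f k) * feature k x = f x - affineFun c x := by
      intro x
      rw [affineFun_eq_sum_feature hcA]
      simp only [populationResidual, sub_mul, Finset.sum_sub_distrib]
      ring
    simp_rw [h3] at h2
    have h4 : empMean X.row (fun x => (f x - affineFun c x) ^ 2) =
        rss X (fun i => f (X i)) A / n := rfl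
    rw [h4, le_div_iff₀ hn'] at h2
    have h5 := hgap A hA
    refine le_trans ?_ h2
    rw [mul_comm]
    exact mul_le_mul_of_nonneg_right (by linarith) hn'.le
  have hlt : n * (L + t) < n * (L + 2 * t) := mul_lt_mul_of_pos_left (by linarith) hn'
  calc ((goodModels p₀ M p).sup fun A => ENNReal.ofReal (rss X (fun i => f (X i)) A))
      ≤ ENNReal.ofReal (n * (L + t)) :=
        Finset.sup_le fun A hA => ENNReal.ofReal_le_ofReal (hgood A hA)
    _ < ENNReal.ofReal (n * (L + 2 * t)) :=
        (ENNReal.ofReal_lt_ofReal_iff (by positivity)).2 hlt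
    _ ≤ _ := Finset.le_inf fun A hA => ENNReal.ofReal_le_ofReal (hbad A hA)

end Separation

/-! ### Concentration over the uniform random design -/

section Design

variable {n p : ℕ} {Ω : Type*} [MeasurableSpace Ω] {P : Measure Ω}
  {X : Ω → Matrix (Fin n) (Fin p) ℝ}

lemma hasLaw_entry_Icc
    (hunif : ∀ i j, HasLaw (fun ω => X ω i j) (volume.restrict (Set.Ico (0 : ℝ) 1)) P)
    (i : Fin n) (j : Fin p) :
    HasLaw (fun ω => X ω i j) (volume.restrict (Set.Icc (0 : ℝ) 1)) P := by
  have h := hunif i j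
  rwa [Measure.restrict_congr_set Ico_ae_eq_Icc] at h

/-- The rows of the design are uniformly distributed on the cube. -/
lemma hasLaw_row
    (hunif : ∀ i j, HasLaw (fun ω => X ω i j) (volume.restrict (Set.Ico (0 : ℝ) 1)) P)
    (hindep : iIndepFun (fun (k : Fin n × Fin p) ω => X ω k.1 k.2) P) (i : Fin n) :
    HasLaw (fun ω => (X ω).row i) (volume.restrict (cube (Fin p))) P := by
  rw [restrict_cube_eq_pi]
  exact iIndepFun.hasLaw_pi (fun j => hasLaw_entry_Icc hunif i j)
    (hindep.precomp (g := fun j => (i, j)) fun a b h => (Prod.ext_iff.1 h).2)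

lemma ae_row_mem_cube
    (hunif : ∀ i j, HasLaw (fun ω => X ω i j) (volume.restrict (Set.Ico (0 : ℝ) 1)) P)
    (hindep : iIndepFun (fun (k : Fin n × Fin p) ω => X ω k.1 k.2) P) :
    ∀ᵐ ω ∂P, ∀ i, (X ω).row i ∈ cube (Fin p) := by
  refine ae_all_iff.2 fun i => ?_
  refine ((hasLaw_row hunif hindep i).ae_iff (p := (· ∈ cube (Fin p))) ?_).2
    (ae_restrict_mem measurableSet_cube)
  exact measurableSet_cube.mem

variable [IsProbabilityMeasure P]

/-- The rows of the design are independent. -/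
lemma iIndepFun_row
    (hunif : ∀ i j, HasLaw (fun ω => X ω i j) (volume.restrict (Set.Ico (0 : ℝ) 1)) P)
    (hindep : iIndepFun (fun (k : Fin n × Fin p) ω => X ω k.1 k.2) P) :
    iIndepFun (fun i ω => (X ω).row i) P := by
  have hfull := hindep.hasLaw_pi fun k : Fin n × Fin p => hasLaw_entry_Icc hunif k.1 k.2
  refine (iIndepFun_iff_hasLaw_pi_pi (hasLaw_row hunif hindep)).2 ?_
  have hcurry := Measure.infinitePi_map_curry (ι := Fin n) (κ := Fin p)
    fun _ _ => (volume : Measure ℝ).restrict (Set.Icc (0 : ℝ) 1)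
  simp only [Measure.infinitePi_eq_pi, ← restrict_cube_eq_pi] at hcurry
  rw [← restrict_cube_eq_pi] at hfull
  exact HasLaw.fun_comp (Y := MeasurableEquiv.curry (Fin n) (Fin p) ℝ)
    ⟨(MeasurableEquiv.measurable _).aemeasurable, hcurry⟩ hfull

/-- The rows are independent and uniform on the cube, so `h` evaluated at them gives independent
variables in `[-B, B]`, sub-Gaussian with parameter `B²` after centring. -/
lemma hoeffding_one_sided
    (hunif : ∀ i j, HasLaw (fun ω => X ω i j) (volume.restrict (Set.Ico (0 : ℝ) 1)) P)
    (hindep : iIndepFun (fun (k : Fin n × Fin p) ω => X ω k.1 k.2) P) (hn : 0 < n)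
    {h : (Fin p → ℝ) → ℝ} (hh : ContinuousOn h (cube (Fin p))) {B t : ℝ}
    (hB : ∀ x ∈ cube (Fin p), |h x| ≤ B) (ht : 0 ≤ t) :
    P {ω | t < empMean (X ω).row h - ∫ x in cube (Fin p), h x} ≤
      ENNReal.ofReal (Real.exp (-(n * t ^ 2 / (2 * B ^ 2)))) := by
  classical
  have hn' : (0 : ℝ) < n := Nat.cast_pos.2 hn
  have hB0 : 0 ≤ B := (abs_nonneg _).trans (hB 0 ⟨le_rfl, zero_le_one⟩)
  set m := ∫ x in cube (Fin p), h x with hm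
  -- Continuity and the bound are known only on the cube; extension by zero is measurable and
  -- bounded everywhere, and agrees with `h` at the rows almost surely.
  let h' : (Fin p → ℝ) → ℝ := (cube (Fin p)).piecewise h 0
  have hmeas : Measurable h' := hh.measurable_piecewise continuousOn_const measurableSet_cube
  have heq : ∀ x ∈ cube (Fin p), h' x = h x := fun x hx => Set.piecewise_eq_of_mem _ _ _ hx
  have hmem : ∀ x, h' x ∈ Set.Icc (-B) B := fun x => by
    by_cases hx : x ∈ cube (Fin p)
    · rw [heq x hx]; exact abs_le.1 (hB x hx)
    · rw [show h' x = 0 from Set.piecewise_eq_of_notMem _ _ _ hx]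
      exact ⟨by linarith, hB0⟩
  have hlaw := hasLaw_row hunif hindep
  have hmean : ∀ i, ∫ ω, h' ((X ω).row i) ∂P = m := fun i => by
    have := (hlaw i).integral_comp (f := h') hmeas.aestronglyMeasurable
    rw [hm, ← setIntegral_congr_fun measurableSet_cube heq]
    exact this
  have hsub : ∀ i ∈ (Finset.univ : Finset (Fin n)),
      HasSubgaussianMGF (fun ω => h' ((X ω).row i) - m) ((‖B - -B‖₊ / 2) ^ 2) P := fun i _ => by
    have := hasSubgaussianMGF_of_mem_Icc (μ := P) (X := fun ω => h' ((X ω).row i)) (a := -B)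
      (b := B) (hmeas.comp_aemeasurable (hlaw i).aemeasurable) (ae_of_all _ fun ω => hmem _)
    rwa [hmean] at this
  have hind : iIndepFun (fun i ω => h' ((X ω).row i) - m) P :=
    (iIndepFun_row hunif hindep).comp (fun _ x => h' x - m) fun _ => hmeas.sub_const m
  have key := HasSubgaussianMGF.measure_sum_ge_le_of_iIndepFun hind hsub (ε := n * t) (by positivity)
  rw [Finset.sum_const, Finset.card_univ, Fintype.card_fin, nsmul_eq_mul] at key
  push_cast at key
  rw [Real.norm_eq_abs, sub_neg_eq_add, ← two_mul, abs_of_nonneg (by positivity)] at key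
  calc P {ω | t < empMean (X ω).row h - m}
      ≤ P {ω | n * t ≤ ∑ i, (h' ((X ω).row i) - m)} := by
        refine measure_mono_ae ?_
        filter_upwards [ae_row_mem_cube hunif hindep] with ω hω hlt
        change n * t ≤ ∑ i, (h' ((X ω).row i) - m)
        have hlt' : t < (∑ i, h ((X ω).row i)) / n - m := hlt
        rw [lt_sub_iff_add_lt, lt_div_iff₀ hn'] at hlt'
        rw [Finset.sum_sub_distrib, Finset.sum_congr rfl fun i _ => heq _ (hω i)]
        simp only [Finset.sum_const, Finset.card_univ, Fintype.card_fin, nsmul_eq_mul]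
        linarith
    _ = ENNReal.ofReal (P.real {ω | n * t ≤ ∑ i, (h' ((X ω).row i) - m)}) := by
        rw [ofReal_measureReal]
    _ ≤ _ := by
        refine ENNReal.ofReal_le_ofReal (key.trans (le_of_eq ?_))
        congr 1
        -- For `B = 0` both exponents vanish by the convention for division by zero.
        rcases eq_or_ne B 0 with rfl | hB'
        · simp
        · field_simp

/-- Hoeffding's inequality for the empirical mean of a continuous function over the design. -/
lemma hoeffding_empMean
    (hunif : ∀ i j, HasLaw (fun ω => X ω i j) (volume.restrict (Set.Ico (0 : ℝ) 1)) P)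
    (hindep : iIndepFun (fun (k : Fin n × Fin p) ω => X ω k.1 k.2) P) (hn : 0 < n)
    {h : (Fin p → ℝ) → ℝ} (hh : ContinuousOn h (cube (Fin p))) {B t : ℝ}
    (hB : ∀ x ∈ cube (Fin p), |h x| ≤ B) (ht : 0 ≤ t) :
    P {ω | t < |empMean (X ω).row h - ∫ x in cube (Fin p), h x|} ≤
      2 * ENNReal.ofReal (Real.exp (-(n * t ^ 2 / (2 * B ^ 2)))) := by
  have h1 := hoeffding_one_sided hunif hindep hn hh hB ht
  have h2 := hoeffding_one_sided hunif hindep hn hh.neg (B := B)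
    (fun x hx => by rw [Pi.neg_apply, abs_neg]; exact hB x hx) ht
  rw [two_mul]
  refine (measure_mono ?_).trans ((measure_union_le _ _).trans (add_le_add h1 h2))
  intro ω hω
  have hω' : t < |empMean (X ω).row h - ∫ x in cube (Fin p), h x| := hω
  rcases lt_abs.1 hω' with hω | hω
  · exact Or.inl hω
  · refine Or.inr ?_
    simp only [Set.mem_ofPred_eq, empMean, Pi.neg_apply, integral_neg, Finset.sum_neg_distrib,
      neg_div] at hω ⊢
    linarith

lemma continuousOn_residualAndFeatures {f : (Fin p → ℝ) → ℝ} (hf : ContinuousOn f (cube (Fin p)))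
    (A : Finset (Fin p)) (a : Option (Option (Fin p))) :
    ContinuousOn (residualAndFeatures f A a) (cube (Fin p)) := by
  cases a with
  | none => exact continuousOn_populationResidual hf A
  | some k => exact (continuous_feature k).continuousOn

/-- A union bound for the deviations of the empirical second moments. -/
lemma measure_not_momentsClose_le
    (hunif : ∀ i j, HasLaw (fun ω => X ω i j) (volume.restrict (Set.Ico (0 : ℝ) 1)) P)
    (hindep : iIndepFun (fun (k : Fin n × Fin p) ω => X ω k.1 k.2) P) (hn : 0 < n)
    {p₀ M : ℕ} {f : (Fin p → ℝ) → ℝ} (hf : ContinuousOn f (cube (Fin p))) {B t : ℝ} (hB1 : 1 ≤ B)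
    (hB : ∀ A ∈ relevantModels p₀ M p, ∀ x ∈ cube (Fin p), populationResidual f A x ^ 2 ≤ B)
    (ht : 0 ≤ t) :
    P {ω | ¬ MomentsClose p₀ M f t (X ω)} ≤ ((relevantModels p₀ M p).card * (p + 2) ^ 2 : ℕ) *
      (2 * ENNReal.ofReal (Real.exp (-(n * t ^ 2 / (2 * B ^ 2))))) := by
  set S := (relevantModels p₀ M p) ×ˢ
    (Finset.univ : Finset (Option (Option (Fin p)) × Option (Option (Fin p)))) with hS
  have hcard : S.card = (relevantModels p₀ M p).card * (p + 2) ^ 2 := by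
    simp [hS, Finset.card_product, sq]
  let F : Finset (Fin p) × Option (Option (Fin p)) × Option (Option (Fin p)) → (Fin p → ℝ) → ℝ :=
    fun s x => residualAndFeatures f s.1 s.2.1 x * residualAndFeatures f s.1 s.2.2 x
  have hsq : ∀ A ∈ relevantModels p₀ M p, ∀ a, ∀ x ∈ cube (Fin p),
      residualAndFeatures f A a x ^ 2 ≤ B := by
    intro A hA a x hx
    cases a with
    | none => exact hB A hA x hx
    | some k =>
      have := sq_le_one_iff_abs_le_one _ |>.2 (abs_feature_le_one k hx)
      exact this.trans hB1
  have hF : ∀ s ∈ S, P {ω | t < |empMean (X ω).row (F s) - ∫ x in cube (Fin p), F s x|} ≤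
      2 * ENNReal.ofReal (Real.exp (-(n * t ^ 2 / (2 * B ^ 2)))) := by
    rintro ⟨A, a, b⟩ hs
    have hA : A ∈ relevantModels p₀ M p := (Finset.mem_product.1 hs).1
    refine hoeffding_empMean hunif hindep hn ((continuousOn_residualAndFeatures hf A a).mul
      (continuousOn_residualAndFeatures hf A b)) (fun x hx => ?_) ht
    have ha := hsq A hA a x hx
    have hb := hsq A hA b x hx
    rw [Pi.mul_apply, abs_le]
    -- `|a b| ≤ (a² + b²) / 2`, so the bound `B` on squares also bounds the products.
    constructor
    · nlinarith [sq_nonneg (residualAndFeatures f A a x + residualAndFeatures f A b x)]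
    · nlinarith [sq_nonneg (residualAndFeatures f A a x - residualAndFeatures f A b x)]
  calc P {ω | ¬ MomentsClose p₀ M f t (X ω)}
      ≤ P (⋃ s ∈ S, {ω | t < |empMean (X ω).row (F s) - ∫ x in cube (Fin p), F s x|}) := by
        refine measure_mono fun ω hω => ?_
        simp only [MomentsClose, not_forall, not_le, Set.mem_ofPred_eq] at hω
        obtain ⟨A, hA, a, b, hlt⟩ := hω
        exact Set.mem_biUnion (x := (A, a, b))
          (Finset.mem_coe.2 (Finset.mem_product.2 ⟨hA, Finset.mem_univ _⟩)) hlt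
    _ ≤ ∑ s ∈ S, P {ω | t < |empMean (X ω).row (F s) - ∫ x in cube (Fin p), F s x|} :=
        measure_biUnion_finset_le _ _
    _ ≤ ∑ s ∈ S, 2 * ENNReal.ofReal (Real.exp (-(n * t ^ 2 / (2 * B ^ 2)))) :=
        Finset.sum_le_sum hF
    _ = _ := by rw [Finset.sum_const, nsmul_eq_mul, hcard]

end Design

/-! ### The population gap and bounds for the residuals -/

section PopulationGap

variable {p₀ M p : ℕ}

lemma mem_cube_castLE (h : p₀ ≤ p) {x : Fin p → ℝ} (hx : x ∈ cube (Fin p)) :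
    (fun i => x (Fin.castLE h i)) ∈ cube (Fin p₀) :=
  ⟨fun _ => hx.1 _, fun _ => hx.2 _⟩

lemma continuousOn_liftFun (h : p₀ ≤ p) {g : (Fin p₀ → ℝ) → ℝ}
    (hg : ContinuousOn g (cube (Fin p₀))) :
    ContinuousOn (liftFun h g) (cube (Fin p)) :=
  hg.comp (by fun_prop) fun _ hx => mem_cube_castLE h hx

lemma card_trueModel_le : (trueModel p₀ p).card ≤ p₀ := by
  have : (trueModel p₀ p).map Fin.valEmbedding ⊆ Finset.range p₀ := by
    intro k hk
    obtain ⟨j, hj, rfl⟩ := Finset.mem_map.1 hk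
    simpa [trueModel] using hj
  simpa using Finset.card_le_card this

lemma card_le_of_mem_relevantModels (hM : p₀ ≤ M) {A : Finset (Fin p)}
    (hA : A ∈ relevantModels p₀ M p) : A.card ≤ M := by
  rcases Finset.mem_insert.1 hA with rfl | hA
  · exact card_trueModel_le.trans hM
  · exact (card_of_mem_badModels hA).le

lemma card_relevantModels_le (hp : 0 < p) : (relevantModels p₀ M p).card ≤ 2 * p ^ M := by
  have h1 : (badModels p₀ M p).card ≤ p ^ M := by
    calc (badModels p₀ M p).card ≤ (Finset.powersetCard M (Finset.univ : Finset (Fin p))).card :=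
          Finset.card_le_card fun A hA => by simpa using card_of_mem_badModels hA
      _ = p.choose M := by simp
      _ ≤ p ^ M := Nat.choose_le_pow p M
  have h2 : 1 ≤ p ^ M := Nat.one_le_pow _ _ hp
  have h3 : (relevantModels p₀ M p).card ≤ (badModels p₀ M p).card + 1 := Finset.card_insert_le _ _
  omega

variable {f : (Fin p → ℝ) → ℝ}

lemma featureNorm_mul_featureCoef_sq (j : Fin p) :
    featureNorm (some j) * featureCoef f (some j) ^ 2 =
      12 * (∫ x in cube (Fin p), feature (some j) x * f x) ^ 2 := by
  rw [featureCoef, featureNorm_some]; ring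

lemma integral_feature_some_mul (hf : ContinuousOn f (cube (Fin p))) (j : Fin p) :
    ∫ x in cube (Fin p), feature (some j) x * f x =
      (∫ x in cube (Fin p), x j * f x) - 1 / 2 * ∫ x in cube (Fin p), f x := by
  have h1 : IntegrableOn (fun x : Fin p → ℝ => x j * f x) (cube (Fin p)) :=
    integrableOn_cube ((continuous_apply j).continuousOn.mul hf)
  have h2 : IntegrableOn (fun x : Fin p → ℝ => 1 / 2 * f x) (cube (Fin p)) :=
    integrableOn_cube (continuousOn_const.mul hf)
  simp only [feature_some, sub_mul]
  rw [integral_sub h1 h2, integral_const_mul]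

/-- The centred coordinate is orthogonal to `liftFun h g`, which does not depend on it. Only its
integral against `f - liftFun h g` remains, with the factor `1/2` bounding the feature. -/
lemma abs_integral_feature_mul_inactive_le (h : p₀ ≤ p) {g : (Fin p₀ → ℝ) → ℝ} {η : ℝ}
    (hf : ContinuousOn f (cube (Fin p))) (hg : ContinuousOn g (cube (Fin p₀)))
    (hfg : ∀ x ∈ cube (Fin p), |f x - liftFun h g x| ≤ η) {j : Fin p} (hj : j ∉ trueModel p₀ p) :
    |∫ x in cube (Fin p), feature (some j) x * f x| ≤ 1 / 2 * η := by
  have hg' := continuousOn_liftFun h hg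
  have h0 : ∫ x in cube (Fin p), feature (some j) x * liftFun h g x = 0 := by
    refine integral_centered_mul_eq_zero j _ fun x => ?_
    have : ∀ i : Fin p₀, reflect j x (Fin.castLE h i) = x (Fin.castLE h i) := fun i => by
      refine if_neg fun e => hj ?_
      rw [← e]; simp [trueModel]
    simp [liftFun, this]
  have h1 : IntegrableOn (fun x => feature (some j) x * f x) (cube (Fin p)) :=
    integrableOn_cube ((continuous_feature _).continuousOn.mul hf)
  have h2 : IntegrableOn (fun x => feature (some j) x * liftFun h g x) (cube (Fin p)) :=
    integrableOn_cube ((continuous_feature _).continuousOn.mul hg')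
  rw [← sub_zero (∫ x in cube (Fin p), feature (some j) x * f x), ← h0, ← integral_sub h1 h2]
  refine abs_integral_cube_le fun x hx => ?_
  rw [← mul_sub, abs_mul]
  exact mul_le_mul (abs_feature_some_le j hx) (hfg x hx) (abs_nonneg _) (by norm_num)

/-- A submodel that misses an active variable has a larger population error than the true one. -/
lemma population_gap (h : p₀ ≤ p) {g : (Fin p₀ → ℝ) → ℝ} {η τ : ℝ} (hτ : 0 < τ)
    (hf : ContinuousOn f (cube (Fin p))) (hg : ContinuousOn g (cube (Fin p₀)))
    (hfg : ∀ x ∈ cube (Fin p), |f x - liftFun h g x| ≤ η)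
    (hactive : ∀ j ∈ trueModel p₀ p,
      τ < |(∫ x in cube (Fin p), x j * f x) - 1 / 2 * ∫ x in cube (Fin p), f x|)
    {A : Finset (Fin p)} (hA : A ∈ badModels p₀ M p) :
    (∫ x in cube (Fin p), populationResidual f (trueModel p₀ p) x ^ 2) +
      (12 * τ ^ 2 - 3 * M * η ^ 2) ≤ ∫ x in cube (Fin p), populationResidual f A x ^ 2 := by
  set T := trueModel p₀ p
  let q : Fin p → ℝ := fun j => featureNorm (some j) * featureCoef f (some j) ^ 2
  have hq : ∀ j, 0 ≤ q j := fun j => mul_nonneg (featureNorm_pos _).le (sq_nonneg _)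
  have hlow : ∀ j ∈ T, 12 * τ ^ 2 ≤ q j := fun j hj => by
    have h1 := hactive j hj
    rw [← integral_feature_some_mul hf] at h1
    have h2 : τ ^ 2 ≤ (∫ x in cube (Fin p), feature (some j) x * f x) ^ 2 := by
      rw [← sq_abs (∫ x in cube (Fin p), feature (some j) x * f x)]
      exact pow_le_pow_left₀ hτ.le h1.le 2
    simp only [q, featureNorm_mul_featureCoef_sq]
    linarith
  have hup : ∀ j ∉ T, q j ≤ 3 * η ^ 2 := fun j hj => by
    have h1 := abs_le.1 (abs_integral_feature_mul_inactive_le h hf hg hfg hj)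
    have h2 := sq_le_sq' h1.1 h1.2
    simp only [q, featureNorm_mul_featureCoef_sq]
    linarith
  have hdiff : 12 * τ ^ 2 ≤ ∑ j ∈ T \ A, q j := by
    simp only [badModels, Finset.mem_filter] at hA
    obtain ⟨j, hj⟩ := hA.2.2
    exact (hlow j (Finset.mem_sdiff.1 hj).1).trans
      (Finset.single_le_sum (fun i _ => hq i) hj)
  have hextra : ∑ j ∈ A \ T, q j ≤ 3 * M * η ^ 2 := by
    calc ∑ j ∈ A \ T, q j ≤ (A \ T).card • (3 * η ^ 2) :=
          Finset.sum_le_card_nsmul _ _ _ fun j hj => hup j (Finset.mem_sdiff.1 hj).2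
      _ = (A \ T).card * (3 * η ^ 2) := nsmul_eq_mul _ _
      _ ≤ M * (3 * η ^ 2) := by
          refine mul_le_mul_of_nonneg_right (Nat.cast_le.2 ?_) (by positivity)
          exact (Finset.card_le_card Finset.sdiff_subset).trans (card_of_mem_badModels hA).le
      _ = _ := by ring
  -- The variables common to `T` and `A` contribute equally to both errors and cancel.
  have hT := Finset.sum_inter_add_sum_sdiff T A q
  have hA' := Finset.sum_inter_add_sum_sdiff A T q
  rw [Finset.inter_comm] at hA'
  rw [integral_populationResidual_sq hf, integral_populationResidual_sq hf,
    Finset.sum_insertNone, Finset.sum_insertNone]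
  change _ - (_ + ∑ j ∈ T, q j) + _ ≤ _ - (_ + ∑ j ∈ A, q j)
  linarith

/-- One `C` comes from `f`, one from the constant term, and `3 C = 12 · (C/2) · (1/2)` from each
variable in `A`. -/
lemma abs_populationResidual_le {C : ℝ} (hC : ∀ x ∈ cube (Fin p), |f x| ≤ C)
    {A : Finset (Fin p)} (hA : A.card ≤ M) {x : Fin p → ℝ} (hx : x ∈ cube (Fin p)) :
    |populationResidual f A x| ≤ (2 + 3 * M) * C := by
  have hC0 : 0 ≤ C := (abs_nonneg _).trans (hC x hx)
  have h0 : |featureCoef f none * feature none x| ≤ C := by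
    rw [feature_none, mul_one, featureCoef, featureNorm_none, div_one]
    exact abs_integral_cube_le fun x hx => by simpa using hC x hx
  have h1 : ∀ j ∈ A, |featureCoef f (some j) * feature (some j) x| ≤ 3 * C := fun j _ => by
    have h2 : |∫ x in cube (Fin p), feature (some j) x * f x| ≤ 1 / 2 * C := by
      refine abs_integral_cube_le fun x hx => ?_
      rw [abs_mul]
      exact mul_le_mul (abs_feature_some_le j hx) (hC x hx) (abs_nonneg _) (by norm_num)
    rw [abs_mul, featureCoef, featureNorm_some, abs_div, abs_of_pos (by norm_num : (0 : ℝ) < 1 / 12)]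
    have h3 := abs_feature_some_le j hx
    calc _ ≤ 1 / 2 * C / (1 / 12) * (1 / 2) := by gcongr
      _ = 3 * C := by ring
  rw [populationResidual, Finset.sum_insertNone]
  have h4 : |∑ j ∈ A, featureCoef f (some j) * feature (some j) x| ≤ 3 * M * C := by
    calc _ ≤ ∑ j ∈ A, |featureCoef f (some j) * feature (some j) x| :=
          Finset.abs_sum_le_sum_abs _ _
      _ ≤ A.card • (3 * C) := Finset.sum_le_card_nsmul _ _ _ h1
      _ = A.card * (3 * C) := nsmul_eq_mul _ _
      _ ≤ M * (3 * C) := mul_le_mul_of_nonneg_right (Nat.cast_le.2 hA) (by positivity)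
      _ = _ := by ring
  have h5 := hC x hx
  rw [abs_le] at h0 h4 h5 ⊢
  constructor <;> linarith [h0.1, h0.2, h4.1, h4.2, h5.1, h5.2]

/-- This brings in the growth of `C₃` and `C₄`, which are stated for `g` in place of `f`. -/
lemma abs_populationResidual_le_residual (h : p₀ ≤ p) (g : (Fin p₀ → ℝ) → ℝ)
    (hf : ContinuousOn f (cube (Fin p))) (A : Finset (Fin p)) (x : Fin p → ℝ) :
    |populationResidual f A x| ≤ |residual h f g A x| + |f x - liftFun h g x| := by
  rw [populationResidual_eq hf]
  refine le_trans (le_of_eq ?_) (abs_add_le _ _)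
  congr 1
  simp only [residual]; ring

end PopulationGap

/-! ### Growth rates -/

section Growth

lemma abs_le_of_cubeSup_le {ι : Type*} {h : (ι → ℝ) → ℝ} {B : ℝ} (hB : 0 ≤ B)
    (hs : cubeSup h ≤ ENNReal.ofReal B) : ∀ x ∈ cube ι, |h x| ≤ B := fun x hx =>
  (ENNReal.ofReal_le_ofReal_iff hB).1
    ((le_iSup₂ (f := fun x (_ : x ∈ cube ι) => ENNReal.ofReal |h x|) x hx).trans hs)

/-- `ENNReal.ofReal` truncates at zero, so the constant may be negative; a nonnegative one is needed
to recover real bounds and multiply them. -/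
lemma IsBigOPow.exists_nonneg {a : ℕ → ℝ≥0∞} {γ : ℝ} (h : IsBigOPow a γ) :
    ∃ C : ℝ, 0 ≤ C ∧ ∀ᶠ n : ℕ in atTop, a n ≤ ENNReal.ofReal (C * (n : ℝ) ^ γ) := by
  obtain ⟨C, hC⟩ := h
  refine ⟨|C|, abs_nonneg C, hC.mono fun n hn => hn.trans (ENNReal.ofReal_le_ofReal ?_)⟩
  exact mul_le_mul_of_nonneg_right (le_abs_self C) (by positivity)

/-- The union bound tends to zero when `log p` grows more slowly than the exponent. -/
lemma tendsto_pow_mul_exp_neg {p : ℕ → ℕ} (hp : ∀ n, 0 < p n) {a b c : ℝ} (m : ℕ) (K : ℝ)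
    (hlog : (fun n => Real.log (p n)) =O[atTop] fun n : ℕ => (n : ℝ) ^ a) (ha : 0 < a)
    (hab : a < b) (hc : 0 < c) :
    Tendsto (fun n : ℕ => K * ((p n : ℝ) ^ m * Real.exp (-(c * (n : ℝ) ^ b)))) atTop (𝓝 0) := by
  obtain ⟨C, hC⟩ := hlog.bound
  rw [← mul_zero K]
  refine Tendsto.const_mul K ?_
  have hcast := tendsto_natCast_atTop_atTop (R := ℝ)
  -- With `n ^ a` factored out, the bracket tends to `-∞` because `b > a`, whatever the power `m` of
  -- `p`.
  have hlim : Tendsto (fun n : ℕ => Real.exp ((n : ℝ) ^ a * (m * C - c * (n : ℝ) ^ (b - a))))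
      atTop (𝓝 0) := by
    refine Real.tendsto_exp_atBot.comp (Tendsto.atTop_mul_atBot₀
      ((tendsto_rpow_atTop ha).comp hcast) ?_)
    have h1 : Tendsto (fun n : ℕ => c * (n : ℝ) ^ (b - a)) atTop atTop :=
      ((tendsto_rpow_atTop (sub_pos.2 hab)).comp hcast).const_mul_atTop hc
    exact tendsto_atBot_add_const_left atTop ((m : ℝ) * C) (tendsto_neg_atTop_atBot.comp h1)
  refine squeeze_zero' (Eventually.of_forall fun n => by positivity) ?_ hlim
  filter_upwards [hC, eventually_gt_atTop 0] with n hn hn0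
  have hp' : (0 : ℝ) < p n := Nat.cast_pos.2 (hp n)
  have hn' : (0 : ℝ) < n := Nat.cast_pos.2 hn0
  rw [Real.norm_eq_abs, Real.norm_eq_abs, abs_of_nonneg (by positivity : 0 ≤ (n : ℝ) ^ a)] at hn
  have h1 : (p n : ℝ) ^ m = Real.exp (m * Real.log (p n)) := by
    rw [mul_comm, Real.exp_mul, Real.exp_log hp', Real.rpow_natCast]
  rw [h1, ← Real.exp_add, Real.exp_le_exp]
  have h2 : (n : ℝ) ^ b = (n : ℝ) ^ a * (n : ℝ) ^ (b - a) := by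
    rw [← Real.rpow_add hn']; congr 1; ring
  rw [h2]
  have h3 : (m : ℝ) * Real.log (p n) ≤ m * (C * (n : ℝ) ^ a) :=
    mul_le_mul_of_nonneg_left ((le_abs_self _).trans hn) (Nat.cast_nonneg m)
  linarith

lemma rpow_mul_rpow_le {n : ℕ} (hn : 0 < n) {a b κ : ℝ} (h : a + b ≤ κ) :
    (n : ℝ) ^ a * (n : ℝ) ^ b ≤ (n : ℝ) ^ κ := by
  rw [← Real.rpow_add (Nat.cast_pos.2 hn)]
  exact Real.rpow_le_rpow_of_exponent_le (Nat.one_le_cast.2 hn) h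

end Growth

end LinearScreening

/-! ### The main theorem -/

theorem theorem4
    -- the fixed sizes of the true and of the screened submodel, and the threshold
    (p₀ M : ℕ) (hM : p₀ ≤ M) (τ : ℝ) (hτ : 0 < τ)
    -- the dimensions
    (p : ℕ → ℕ) (hp : ∀ n, p₀ < p n)
    -- the computer models, continuous on the cube
    (f : ∀ n, (Fin (p n) → ℝ) → ℝ) (hf : ∀ n, ContinuousOn (f n) (cube (Fin (p n))))
    -- the approximation of the models by continuous functions of the first `p₀` variables
    (g : ℕ → (Fin p₀ → ℝ) → ℝ) (hg : ∀ n, ContinuousOn (g n) (cube (Fin p₀)))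
    (η : ℕ → ℝ) (hη : ∀ n, 0 < η n)
    (happrox : ∀ n,
      cubeSup (fun x => f n x - liftFun (hp n).le (g n) x) < ENNReal.ofReal (η n))
    -- the first `p₀` variables are active
    (hactive : ∀ n, ∀ j ∈ trueModel p₀ (p n),
      τ < |(∫ x in cube (Fin (p n)), x j * f n x) - 1 / 2 * ∫ x in cube (Fin (p n)), f n x|)
    -- bounded variation in the sense of Hardy and Krause
    (hBV : ∀ n, hkVariation (g n) < ∞)
    -- the design consists of i.i.d. uniform random variables on `[0, 1)`
    {Ω : ℕ → Type*} [∀ n, MeasurableSpace (Ω n)]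
    (P : ∀ n, Measure (Ω n)) [∀ n, IsProbabilityMeasure (P n)]
    (X : ∀ n, Ω n → Matrix (Fin n) (Fin (p n)) ℝ)
    (hunif : ∀ n i j, HasLaw (fun ω => X n ω i j) (volume.restrict (Set.Ico (0 : ℝ) 1)) (P n))
    (hindep : ∀ n,
      iIndepFun (fun (k : Fin n × Fin (p n)) ω => X n ω k.1 k.2) (P n))
    -- the growth rates
    (γ₁ γ₂ γ₃ γ₄ γ₅ γ₆ γ₇ γ₁₀ γ₀ : ℝ) (hγ₀ : γ₀ = (1 - γ₁₀) / 2)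
    (hηO : η =O[atTop] fun n : ℕ => (n : ℝ) ^ (-γ₁))
    (hV₁ : IsBigOPow (fun n => V₁ (hp n).le (f n) (g n)) γ₂)
    (hV₂ : IsBigOPow (fun n => V₂ M (hp n).le (f n) (g n)) γ₃)
    (hC₁ : IsBigOPow (fun n => C₁ (hp n).le (g n)) γ₄)
    (hC₂ : IsBigOPow (fun n => C₂ (f n)) γ₅)
    (hC₃ : IsBigOPow (fun n => C₃ (hp n).le (f n) (g n)) γ₆)
    (hC₄ : IsBigOPow (fun n => C₄ M (hp n).le (f n) (g n)) γ₇)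
    (hlogp : (fun n => Real.log (p n)) =O[atTop] fun n : ℕ => (n : ℝ) ^ γ₁₀)
    (h₁ : 0 < γ₁) (h₁₀ : 0 < γ₁₀) (h₁₀' : γ₁₀ < 1)
    (h₂ : γ₂ < γ₀) (h₃ : γ₃ < γ₀) (h₄ : γ₄ < γ₀) (h₅ : γ₅ < γ₀)
    (h₇₁ : γ₇ < γ₁) (h₆₁ : γ₆ < γ₁)
    (h₄₆ : γ₄ + γ₆ < γ₀) (h₅₆ : γ₅ + γ₆ < γ₀) (h₄₇ : γ₄ + γ₇ < γ₀) (h₅₇ : γ₅ + γ₇ < γ₀) :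
    Tendsto (fun n => P n {ω | Separates p₀ M (X n ω) (fun i => f n (X n ω i))}) atTop (𝓝 1) := by
  obtain ⟨a₂, ha₂, hC₂⟩ := hC₂.exists_nonneg
  obtain ⟨a₃, ha₃, hC₃⟩ := hC₃.exists_nonneg
  obtain ⟨a₄, ha₄, hC₄⟩ := hC₄.exists_nonneg
  obtain ⟨c, hc, hηc⟩ := hηO.exists_nonneg
  have hηle : ∀ᶠ n : ℕ in atTop, η n ≤ c * (n : ℝ) ^ (-γ₁) := by
    filter_upwards [hηc.bound] with n hn
    rw [Real.norm_eq_abs, Real.norm_eq_abs, abs_of_pos (hη n), abs_of_nonneg (by positivity)] at hn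
    exact hn
  have hη0 : Tendsto η atTop (𝓝 0) := hηO.trans_tendsto
    ((tendsto_rpow_neg_atTop h₁).comp tendsto_natCast_atTop_atTop)
  have hfg : ∀ n, ∀ x ∈ cube (Fin (p n)), |f n x - liftFun (hp n).le (g n) x| ≤ η n := fun n =>
    abs_le_of_cubeSup_le (hη n).le (happrox n).le
  -- a bound of order `n ^ κ` for the squared population residuals
  obtain ⟨κ, hκ, hκ0, hκ5, hκ6, hκ7⟩ : ∃ κ, κ < γ₀ ∧ 0 ≤ κ ∧ γ₅ ≤ κ ∧ γ₅ + γ₆ ≤ κ ∧ γ₅ + γ₇ ≤ κ :=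
    ⟨max (max 0 γ₅) (max (γ₅ + γ₆) (γ₅ + γ₇)),
      max_lt (max_lt (by rw [hγ₀]; linarith) h₅) (max_lt h₅₆ h₅₇), by simp, by simp, by simp,
      by simp⟩
  -- The summand `1` ensures `K * n ^ κ ≥ 1`, so that the same bound covers the squared features.
  set K : ℝ := (2 + 3 * M) * a₂ * (a₃ + a₄ + c) + 1 with hK
  have hK1 : 1 ≤ K := by rw [hK]; linarith [show 0 ≤ (2 + 3 * M) * a₂ * (a₃ + a₄ + c) by positivity]
  have hres : ∀ᶠ n : ℕ in atTop, ∀ A ∈ relevantModels p₀ M (p n), ∀ x ∈ cube (Fin (p n)),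
      populationResidual (f n) A x ^ 2 ≤ K * (n : ℝ) ^ κ := by
    filter_upwards [hC₂, hC₃, hC₄, hηle, eventually_gt_atTop 0] with n h2 h3 h4 h5 hn A hA x hx
    have hn0 : (0 : ℝ) ≤ (n : ℝ) ^ κ := by positivity
    have hf2 := abs_le_of_cubeSup_le (by positivity) h2
    have hr1 := abs_populationResidual_le hf2 (card_le_of_mem_relevantModels hM hA) hx
    have hr2 : |residual (hp n).le (f n) (g n) A x| ≤ a₃ * (n : ℝ) ^ γ₆ + a₄ * (n : ℝ) ^ γ₇ := by
      rcases Finset.mem_insert.1 hA with rfl | hA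
      · have := abs_le_of_cubeSup_le (by positivity) h3 x hx
        linarith [show 0 ≤ a₄ * (n : ℝ) ^ γ₇ by positivity]
      · have h6 : cubeSup (residual (hp n).le (f n) (g n) A) ≤ _ :=
          (le_iSup₂ (f := fun A (_ : A ∈ badModels p₀ M (p n)) =>
            cubeSup (residual (hp n).le (f n) (g n) A)) A hA).trans h4
        have := abs_le_of_cubeSup_le (by positivity) h6 x hx
        linarith [show 0 ≤ a₃ * (n : ℝ) ^ γ₆ by positivity]
    have hr3 := abs_populationResidual_le_residual (hp n).le (g n) (hf n) A x
    have hr4 : |populationResidual (f n) A x| ≤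
        a₃ * (n : ℝ) ^ γ₆ + a₄ * (n : ℝ) ^ γ₇ + c * (n : ℝ) ^ (-γ₁) := by
      linarith [hfg n x hx]
    have e6 := rpow_mul_rpow_le hn hκ6
    have e7 := rpow_mul_rpow_le hn hκ7
    have e1 := rpow_mul_rpow_le hn (show γ₅ + -γ₁ ≤ κ by linarith)
    -- The square is bounded by the product of two different bounds, of orders `n ^ γ₅` and `n ^ γ₆
    -- + n ^ γ₇ + n ^ (-γ₁)`; this is what the conditions on `γ₅ + γ₆` and `γ₅ + γ₇` serve.
    rw [← sq_abs, sq]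
    calc |populationResidual (f n) A x| * |populationResidual (f n) A x|
        ≤ (2 + 3 * M) * (a₂ * (n : ℝ) ^ γ₅) *
          (a₃ * (n : ℝ) ^ γ₆ + a₄ * (n : ℝ) ^ γ₇ + c * (n : ℝ) ^ (-γ₁)) :=
          mul_le_mul hr1 hr4 (abs_nonneg _) (by positivity)
      _ = (2 + 3 * M) * a₂ * (a₃ * ((n : ℝ) ^ γ₅ * (n : ℝ) ^ γ₆) +
          a₄ * ((n : ℝ) ^ γ₅ * (n : ℝ) ^ γ₇) + c * ((n : ℝ) ^ γ₅ * (n : ℝ) ^ (-γ₁))) := by ring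
      _ ≤ (2 + 3 * M) * a₂ * (a₃ * (n : ℝ) ^ κ + a₄ * (n : ℝ) ^ κ + c * (n : ℝ) ^ κ) := by gcongr
      _ ≤ K * (n : ℝ) ^ κ := by rw [hK]; linarith
  -- the tolerance for the moments
  obtain ⟨t, ht, htM, htτ⟩ : ∃ t : ℝ, 0 < t ∧ t * (M + 1) ≤ 1 / 24 ∧ t ≤ τ ^ 2 := by
    refine ⟨min (1 / 24 / (M + 1)) (τ ^ 2), by positivity, ?_, min_le_right _ _⟩
    exact (le_div_iff₀ (by positivity)).1 (min_le_left _ _)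
  have hgap : ∀ᶠ n : ℕ in atTop, ∀ A ∈ badModels p₀ M (p n),
      (∫ x in cube (Fin (p n)), populationResidual (f n) (trueModel p₀ (p n)) x ^ 2) + 4 * t ≤
        ∫ x in cube (Fin (p n)), populationResidual (f n) A x ^ 2 := by
    have h1 : Tendsto (fun n => 3 * (M : ℝ) * η n ^ 2) atTop (𝓝 0) := by
      simpa using (hη0.pow 2).const_mul (3 * (M : ℝ))
    -- Once `3 M η² < τ²`, the gap exceeds `11 τ²`, more than the required `4 t ≤ 4 τ²`.
    filter_upwards [h1.eventually_lt_const (show 0 < τ ^ 2 by positivity)] with n hn A hA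
    have := population_gap (hp n).le hτ (hf n) (hg n) (hfg n) (hactive n) hA
    linarith [show 0 < τ ^ 2 by positivity]
  -- the probability of the exceptional event
  have hp0 : ∀ n, 0 < p n := fun n => (Nat.zero_le p₀).trans_lt (hp n)
  -- There are at most `2 p ^ M` submodels and `(p + 2)² ≤ 9 p²` pairs of functions; the two tails
  -- turn `18` into `36`.
  have hlim := tendsto_pow_mul_exp_neg (b := 1 - 2 * κ) (c := t ^ 2 / (2 * K ^ 2)) hp0 (M + 2) 36
    hlogp h₁₀ (by rw [hγ₀] at hκ; linarith) (by positivity)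
  have hlim' := ENNReal.tendsto_ofReal hlim
  rw [ENNReal.ofReal_zero] at hlim'
  have hlow := ENNReal.Tendsto.sub (tendsto_const_nhds (x := (1 : ℝ≥0∞))) hlim'
    (Or.inl ENNReal.one_ne_top)
  rw [tsub_zero] at hlow
  refine tendsto_of_tendsto_of_tendsto_of_le_of_le' hlow tendsto_const_nhds ?_
    (Eventually.of_forall fun n => prob_le_one)
  filter_upwards [hres, hgap, eventually_gt_atTop 0] with n hres hgap hn
  have hn' : (0 : ℝ) < n := Nat.cast_pos.2 hn
  have hB1 : 1 ≤ K * (n : ℝ) ^ κ :=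
    one_le_mul_of_one_le_of_one_le hK1 (Real.one_le_rpow (Nat.one_le_cast.2 hn) hκ0)
  have hbound := measure_not_momentsClose_le (hunif n) (hindep n) hn (hf n) hB1 hres ht.le
  have hexp : n * t ^ 2 / (2 * (K * (n : ℝ) ^ κ) ^ 2) =
      t ^ 2 / (2 * K ^ 2) * (n : ℝ) ^ (1 - 2 * κ) := by
    have h1 : (n : ℝ) ^ (1 - 2 * κ) = n / ((n : ℝ) ^ κ) ^ 2 := by
      rw [Real.rpow_sub hn', Real.rpow_one, mul_comm 2 κ, Real.rpow_mul hn'.le]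
      norm_num
    rw [h1]
    have : (n : ℝ) ^ κ ≠ 0 := by positivity
    field_simp
  rw [hexp] at hbound
  have hcard : (relevantModels p₀ M (p n)).card * (p n + 2) ^ 2 ≤ 18 * p n ^ (M + 2) := by
    have h3 : p n + 2 ≤ 3 * p n := by have := hp0 n; omega
    calc _ ≤ (2 * p n ^ M) * (3 * p n) ^ 2 :=
          Nat.mul_le_mul (card_relevantModels_le (hp0 n)) (Nat.pow_le_pow_left h3 2)
      _ = _ := by ring
  set S := {ω | Separates p₀ M (X n ω) fun i => f n (X n ω i)}
  have hcompl : P n Sᶜ ≤ ENNReal.ofReal (36 * ((p n : ℝ) ^ (M + 2) *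
      Real.exp (-(t ^ 2 / (2 * K ^ 2) * (n : ℝ) ^ (1 - 2 * κ))))) := by
    calc P n Sᶜ ≤ P n {ω | ¬ MomentsClose p₀ M (f n) t (X n ω)} :=
          measure_mono fun ω hω h => hω (h.separates (hf n) hn ht htM hgap)
      _ ≤ _ := hbound
      _ ≤ ((18 * p n ^ (M + 2) : ℕ) : ℝ≥0∞) * (2 * ENNReal.ofReal
          (Real.exp (-(t ^ 2 / (2 * K ^ 2) * (n : ℝ) ^ (1 - 2 * κ))))) := by
          gcongr
      _ = _ := by
          rw [← ENNReal.ofReal_natCast, show (2 : ℝ≥0∞) = ENNReal.ofReal 2 by simp,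
            ← ENNReal.ofReal_mul (by norm_num), ← ENNReal.ofReal_mul (by positivity)]
          congr 1
          push_cast
          ring
  -- Subadditivity suffices here, so measurability of `S` need not be established.
  have htot : 1 ≤ P n S + P n Sᶜ := by
    calc 1 = P n (S ∪ Sᶜ) := by rw [Set.union_compl_self, measure_univ]
      _ ≤ _ := measure_union_le _ _
  exact tsub_le_iff_right.2 (htot.trans (by gcongr))
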